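/- Let $(\mathcal C,\otimes,I,\phi)$ be a braided monoidal category with equalizers, and let $B$, $L$, $F$ be flat Hopf algebras in $\mathcal C$ (an object is flat if tensoring with it preserves equalizers). Let ${}^B\mathcal C$ and ${}^L\mathcal C$ be the monoidal categories of left comodules, with the diagonal coaction on tensor products, and for $X\in\mathcal C$ let $X^t$ denote $X$ with the trivial coaction $\eta\otimes X$. Let $\alpha:{}^B\mathcal C\to{}^L\mathcal C$ be a strong monoidal equivalence, with structure isomorphisms $\varphi_{M,N}:\alpha(M)\otimes\alpha(N)\to\alpha(M\otimes N)$. Assume that (1) $\alpha$ is trivializable on $\mathcal C$: there is an isomorphism of monoidal functors $\tau:\alpha((-)^t)\cong(-)^t$ from $\mathcal C$ to ${}^L\mathcal C$ (fix one); (2) $\alpha$ satisfies $(\mathbb A)$: for all $X\in\mathcal C$ and $M\in{}^B\mathcal C$, as morphisms of $\mathcal C$, $$\varphi_{M,X^t}\circ\phi_{\alpha(X^t),\alpha(M)}=\alpha(\phi_{X,M})\circ\varphi_{X^t,M},$$ where $\phi_{X,M}:X^t\otimes M\to M\otimes X^t$ is regarded as a morphism of ${}^B\mathcal C$. For a $B$-$F$-bicomodule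 algebra $M$ in $\mathcal C$, regard $\alpha(M)$ as an $L$-$F$-bicomodule algebra with the left $L$-coaction of $\alpha(M)\in{}^L\mathcal C$, the multiplication $\alpha(M)\otimes\alpha(M)\xrightarrow{\varphi}\alpha(M\otimes M)\to\alpha(M)$, the unit $I\cong\alpha(I)\to\alpha(M)$, and the right $F$-coaction $$\alpha(M)\xrightarrow{\alpha(\chi^+_M)}\alpha(M\otimes F^t)\xrightarrow{\varphi^{-1}}\alpha(M)\otimes\alpha(F^t)\xrightarrow{\alpha(M)\otimes\tau_F}\alpha(M)\otimes F .$$ In particular $\alpha(B)$ is an $L$-$B$-bicomodule algebra, where $B$ is a $B$-$B$-bicomodule algebra through its comultiplication. Let $\alpha(B)\,\square_B\,M$ be the equalizer of $\chi^+_{\alpha(B)}\otimes M$ and $\alpha(B)\otimes\chi^-_M$, with the $L$-$F$-bicomodule algebra structure induced from $\alpha(B)\otimes M$ (the algebra structure uses the braiding, the coactions are those of $\alpha(B)$ on the left and of $M$ on the right). Then, for every $B$-$F$-bicomodule algebra $M$ in $\mathcal C$, $$\alpha(M)\;\cong\;\alpha(B)\,\square_B\,M$$ as $L$-$F$-bicomodule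 algebras in $\mathcal C$. -/

import Mathlib

open CategoryTheory MonoidalCategory BraidedCategory Limits
open scoped MonObj ComonObj

universe v u

namespace BraidedHopf

variable {C : Type u} [Category.{v} C] [MonoidalCategory C] [BraidedCategory C]

/-- A left comodule `X` over the coalgebra `B`, with coaction `χ⁻ : X ⟶ B ⊗ X`. -/
structure LComod (B : C) [BimonObj B] where
  X : C
  coact : X ⟶ B ⊗ X
  counit : coact ≫ ε[B] ▷ X = (λ_ X).inv
  coassoc : coact ≫ B ◁ coact = coact ≫ Δ[B] ▷ X ≫ (α_ B B X).hom

namespace LComod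

variable {B : C} [BimonObj B]

attribute [simp] counit

/-- Morphisms of left comodules: colinear morphisms. -/
@[ext]
structure Hom (M N : LComod B) where
  hom : M.X ⟶ N.X
  colinear : hom ≫ N.coact = M.coact ≫ B ◁ hom

instance : Category (LComod B) where
  Hom M N := Hom M N
  id M := ⟨𝟙 M.X, by simp⟩
  comp f g := ⟨f.hom ≫ g.hom, by
    rw [Category.assoc, g.colinear, reassoc_of% f.colinear, MonoidalCategory.whiskerLeft_comp]⟩

@[simp] lemma id_hom (M : LComod B) : Hom.hom (𝟙 M) = 𝟙 M.X := rfl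
@[simp] lemma comp_hom {M N P : LComod B} (f : M ⟶ N) (g : N ⟶ P) :
    (f ≫ g).hom = f.hom ≫ g.hom := rfl
@[ext] lemma hom_ext {M N : LComod B} {f g : M ⟶ N} (h : f.hom = g.hom) : f = g := Hom.ext h

@[simps] abbrev mkIso {M N : LComod B} (e : M.X ≅ N.X) (h : e.hom ≫ N.coact = M.coact ≫ B ◁ e.hom) :
    M ≅ N where
  hom := ⟨e.hom, h⟩
  inv := ⟨e.inv, by rw [Iso.inv_comp_eq, ← Category.assoc, h]; simp⟩
  hom_inv_id := by ext; simp
  inv_hom_id := by ext; simp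

variable (B) in
/-- Swap the middle factors with the braiding and multiply the two copies of `B`. -/
def str (M N : C) : (B ⊗ M) ⊗ (B ⊗ N) ⟶ B ⊗ (M ⊗ N) :=
  tensorμ B M B N ≫ μ[B] ▷ (M ⊗ N)

lemma str_natural {M N M' N' : C} (f : M ⟶ M') (g : N ⟶ N') :
    (B ◁ f ⊗ₘ B ◁ g) ≫ str B M' N' = str B M N ≫ B ◁ (f ⊗ₘ g) := by
  have := tensorμ_natural (𝟙 B) f (𝟙 B) g
  rw [id_tensorHom, id_tensorHom, id_tensorHom_id, id_tensorHom] at this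
  simp only [str, reassoc_of% this, Category.assoc, whisker_exchange]

lemma str_assoc (M N P : C) :
    str B M N ▷ (B ⊗ P) ≫ str B (M ⊗ N) P ≫ B ◁ (α_ M N P).hom =
      (α_ _ _ _).hom ≫ (B ⊗ M) ◁ str B N P ≫ str B M (N ⊗ P) := by
  have h := tensor_associativity B M B N B P
  have h1 := tensorμ_natural_left (μ[B]) (𝟙 (M ⊗ N)) B P
  have h2 := tensorμ_natural_right B M (μ[B]) (𝟙 (N ⊗ P))
  simp only [tensorHom_id, id_whiskerRight, whiskerLeft_id] at h1 h2
  simp only [str, comp_whiskerRight, Category.assoc, MonoidalCategory.whiskerLeft_comp,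
    reassoc_of% h1, reassoc_of% h2]
  have h3 : (tensorμ B M B N ▷ (B ⊗ P)) ≫ tensorμ (B ⊗ B) (M ⊗ N) B P =
    (α_ (B ⊗ M) (B ⊗ N) (B ⊗ P)).hom ≫
        ((B ⊗ M) ◁ tensorμ B N B P) ≫ tensorμ B M (B ⊗ B) (N ⊗ P) ≫
          ((α_ _ _ _).inv ⊗ₘ (α_ _ _ _).inv) := by
    rw [← reassoc_of% h]; simp
  rw [reassoc_of% h3]
  simp only [MonoidalCategory.tensorHom_def, Category.assoc]
  rw [← whisker_exchange_assoc, ← comp_whiskerRight_assoc, ← comp_whiskerRight_assoc]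
  rw [Category.assoc, MonObj.mul_assoc, Iso.inv_hom_id_assoc]
  rw [whisker_exchange_assoc, ← MonoidalCategory.whiskerLeft_comp, Iso.inv_hom_id,
    MonoidalCategory.whiskerLeft_id, Category.comp_id, comp_whiskerRight]

lemma str_comul (M N : C) :
    ((Δ[B] ▷ M ≫ (α_ B B M).hom) ⊗ₘ (Δ[B] ▷ N ≫ (α_ B B N).hom)) ≫
      str B (B ⊗ M) (B ⊗ N) ≫ B ◁ str B M N =
      str B M N ≫ Δ[B] ▷ (M ⊗ N) ≫ (α_ _ _ _).hom := by
  have h := associator_monoidal B B M B B N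
  have h1 := tensorμ_natural Δ[B] (𝟙 M) Δ[B] (𝟙 N)
  simp only [tensorHom_id, id_whiskerRight] at h1
  simp only [str, MonoidalCategory.whiskerLeft_comp, Category.assoc]
  rw [← whisker_exchange_assoc, ← tensorHom_comp_tensorHom_assoc, ← reassoc_of% h,
    reassoc_of% h1, ← comp_whiskerRight_assoc (μ[B]), BimonObj.mul_comul]
  simp only [MonoidalCategory.tensorHom_def (μ[B]) (μ[B]), comp_whiskerRight, Category.assoc]
  congr 3
  rw [associator_naturality_middle, ← associator_naturality_left_assoc]

lemma str_counit (M N : C) :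
    str B M N ≫ ε[B] ▷ (M ⊗ N) ≫ (λ_ _).hom =
      (ε[B] ▷ M ≫ (λ_ M).hom ⊗ₘ ε[B] ▷ N ≫ (λ_ N).hom) := by
  have h1 := tensorμ_natural ε[B] (𝟙 M) ε[B] (𝟙 N)
  simp only [tensorHom_id, id_whiskerRight] at h1
  rw [← tensorHom_comp_tensorHom, leftUnitor_monoidal, reassoc_of% h1]
  simp only [str, Category.assoc, ← comp_whiskerRight_assoc, BimonObj.mul_counit]
  simp

/-- The diagonal coaction. -/
@[simps] abbrev tensor (M N : LComod B) : LComod B where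
  X := M.X ⊗ N.X
  coact := (M.coact ⊗ₘ N.coact) ≫ str B M.X N.X
  counit := by
    rw [← cancel_mono (λ_ _).hom]
    simp only [Category.assoc, str_counit, tensorHom_comp_tensorHom, reassoc_of% LComod.counit,
      Iso.inv_hom_id, id_tensorHom_id]
  coassoc := by
    simp only [Category.assoc, MonoidalCategory.whiskerLeft_comp]
    rw [← reassoc_of% str_natural, tensorHom_comp_tensorHom_assoc, M.coassoc, N.coassoc,
      ← tensorHom_comp_tensorHom_assoc, str_comul]

/-- The trivial comodule `Xᵗ`. -/
@[simps] abbrev trivObj (B : C) [BimonObj B] (X : C) : LComod B where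
  X := X
  coact := (λ_ X).inv ≫ η[B] ▷ X
  counit := by simp [← comp_whiskerRight]
  coassoc := by
    simp only [Category.assoc, ← comp_whiskerRight_assoc, BimonObj.one_comul,
      MonObj.tensorObj.one_def]
    simp only [MonoidalCategory.whiskerLeft_comp, comp_whiskerRight, Category.assoc,
      MonoidalCategory.tensorHom_def]
    rw [associator_naturality_middle, ← whisker_exchange_assoc]
    simp

/-- Colinear maps out of a tensor product. -/
lemma tensorHom_colinear {M N M' N' : LComod B} (f : M ⟶ M') (g : N ⟶ N') :
    (f.hom ⊗ₘ g.hom) ≫ (tensor M' N').coact = (tensor M N).coact ≫ B ◁ (f.hom ⊗ₘ g.hom) := by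
  dsimp only [tensor]
  rw [Category.assoc, ← str_natural, tensorHom_comp_tensorHom_assoc,
    tensorHom_comp_tensorHom_assoc, f.colinear, g.colinear]

lemma assoc_colinear (M N P : LComod B) :
    (α_ M.X N.X P.X).hom ≫ (tensor M (tensor N P)).coact =
      (tensor (tensor M N) P).coact ≫ B ◁ (α_ M.X N.X P.X).hom := by
  dsimp only [tensor]
  have h1 : (M.coact ⊗ₘ N.coact) ≫ str B M.X N.X ⊗ₘ P.coact =
    ((M.coact ⊗ₘ N.coact) ⊗ₘ P.coact) ≫ str B M.X N.X ▷ _ := by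
    rw [← tensorHom_id, tensorHom_comp_tensorHom, Category.comp_id]
  have h2 : M.coact ⊗ₘ ((N.coact ⊗ₘ P.coact) ≫ str B N.X P.X) =
    (M.coact ⊗ₘ (N.coact ⊗ₘ P.coact)) ≫ _ ◁ str B N.X P.X := by
    rw [← id_tensorHom, tensorHom_comp_tensorHom, Category.comp_id]
  rw [h1, h2]
  simp only [Category.assoc]
  rw [str_assoc, associator_naturality_assoc]

lemma str_trivial_left (M : LComod B) (X : C) :
    ((trivObj B X).coact ⊗ₘ M.coact) ≫ str B X M.X =
      X ◁ M.coact ≫ (α_ _ _ _).inv ≫ (β_ X B).hom ▷ M.X ≫ (α_ _ _ _).hom := by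
  have h := tensorμ_natural_left η[B] (𝟙 X) B M.X
  rw [tensorHom_id, id_whiskerRight, tensorHom_id] at h
  simp only [trivObj, str]
  rw [tensorHom_def', Category.assoc, comp_whiskerRight_assoc, reassoc_of% h,
    ← comp_whiskerRight, MonObj.one_mul]
  congr 1
  dsimp only [tensorμ]
  monoidal

lemma str_trivial_right (M : LComod B) (X : C) :
    (M.coact ⊗ₘ (trivObj B X).coact) ≫ str B M.X X =
      M.coact ▷ X ≫ (α_ _ _ _).hom := by
  have h := tensorμ_natural_right B M.X η[B] (𝟙 X)
  rw [tensorHom_id, whiskerLeft_id, tensorHom_id] at h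
  simp only [trivObj, str]
  rw [MonoidalCategory.tensorHom_def, Category.assoc, MonoidalCategory.whiskerLeft_comp_assoc,
    reassoc_of% h, ← comp_whiskerRight, MonObj.mul_one]
  congr 1
  dsimp only [tensorμ]
  rw [braiding_tensorUnit_right]
  monoidal

variable (B) in
/-- The braiding of `C` is colinear as a map `Xᵗ ⊗ M ⟶ M ⊗ Xᵗ`. -/
lemma braiding_colinear (X : C) (M : LComod B) :
    (β_ X M.X).hom ≫ (tensor M (trivObj B X)).coact =
      (tensor (trivObj B X) M).coact ≫ B ◁ (β_ X M.X).hom := by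
  rw [tensor_coact, tensor_coact, str_trivial_left, str_trivial_right]
  rw [← braiding_naturality_right_assoc, braiding_tensor_right_hom]
  simp

lemma leftUnitor_colinear (M : LComod B) :
    (λ_ M.X).hom ≫ M.coact = (tensor (trivObj B (𝟙_ C)) M).coact ≫ B ◁ (λ_ M.X).hom := by
  rw [tensor_coact, str_trivial_left]
  simp [braiding_tensorUnit_left]

lemma rightUnitor_colinear (M : LComod B) :
    (ρ_ M.X).hom ≫ M.coact = (tensor M (trivObj B (𝟙_ C))).coact ≫ B ◁ (ρ_ M.X).hom := by
  rw [tensor_coact, str_trivial_right]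
  simp

lemma triv_tensor_colinear (X Y : C) :
    (trivObj B (X ⊗ Y)).coact = (tensor (trivObj B X) (trivObj B Y)).coact := by
  rw [tensor_coact, str_trivial_right]
  simp

instance : MonoidalCategoryStruct (LComod B) where
  tensorObj M N := tensor M N
  tensorUnit := trivObj B (𝟙_ C)
  tensorHom f g := ⟨f.hom ⊗ₘ g.hom, tensorHom_colinear f g⟩
  whiskerLeft M _ _ g := ⟨M.X ◁ g.hom, by
    rw [← id_tensorHom]; exact tensorHom_colinear (𝟙 M) g⟩
  whiskerRight f N := ⟨f.hom ▷ N.X, by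
    rw [← tensorHom_id]; exact tensorHom_colinear f (𝟙 N)⟩
  associator M N P := mkIso (α_ M.X N.X P.X) (assoc_colinear M N P)
  leftUnitor M := mkIso (λ_ M.X) (leftUnitor_colinear M)
  rightUnitor M := mkIso (ρ_ M.X) (rightUnitor_colinear M)

@[simp] lemma tensorUnit_X : (𝟙_ (LComod B)).X = 𝟙_ C := rfl
@[simp] lemma tensorUnit_coact : (𝟙_ (LComod B)).coact = (λ_ (𝟙_ C)).inv ≫ η[B] ▷ 𝟙_ C := rfl
lemma tensorObj_coact (M N : LComod B) :
    (M ⊗ N).coact = (M.coact ⊗ₘ N.coact) ≫ str B M.X N.X := rfl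
@[simp] lemma tensorObj_X (M N : LComod B) : (M ⊗ N).X = M.X ⊗ N.X := rfl
@[simp] lemma tensorHom_hom {M N M' N' : LComod B} (f : M ⟶ M') (g : N ⟶ N') :
    (f ⊗ₘ g).hom = f.hom ⊗ₘ g.hom := rfl
@[simp] lemma whiskerLeft_hom (M : LComod B) {N N' : LComod B} (g : N ⟶ N') :
    (M ◁ g).hom = M.X ◁ g.hom := rfl
@[simp] lemma whiskerRight_hom {M M' : LComod B} (f : M ⟶ M') (N : LComod B) :
    (f ▷ N).hom = f.hom ▷ N.X := rfl
@[simp] lemma associator_hom_hom (M N P : LComod B) :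
    (α_ M N P).hom.hom = (α_ M.X N.X P.X).hom := rfl
@[simp] lemma associator_inv_hom (M N P : LComod B) :
    (α_ M N P).inv.hom = (α_ M.X N.X P.X).inv := rfl
@[simp] lemma leftUnitor_hom_hom (M : LComod B) : (λ_ M).hom.hom = (λ_ M.X).hom := rfl
@[simp] lemma leftUnitor_inv_hom (M : LComod B) : (λ_ M).inv.hom = (λ_ M.X).inv := rfl
@[simp] lemma rightUnitor_hom_hom (M : LComod B) : (ρ_ M).hom.hom = (ρ_ M.X).hom := rfl
@[simp] lemma rightUnitor_inv_hom (M : LComod B) : (ρ_ M).inv.hom = (ρ_ M.X).inv := rfl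

/-- The monoidal category `ᴮC` of left `B`-comodules, with the diagonal coaction on tensor
products; the constraints are those of `C`. -/
instance : MonoidalCategory (LComod B) where
  tensorHom_def f g := by ext; simp [MonoidalCategory.tensorHom_def]
  id_tensorHom_id M N := by ext; simp
  tensorHom_comp_tensorHom f₁ f₂ g₁ g₂ := by ext; simp
  whiskerLeft_id M N := by ext; simp
  id_whiskerRight M N := by ext; simp
  associator_naturality f g h := by ext; simp
  leftUnitor_naturality f := by ext; simp
  rightUnitor_naturality f := by ext; simp
  pentagon M N P Q := by ext; simp
  triangle M N := by ext; simp

variable (B) in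
/-- The functor `X ↦ Xᵗ` embedding `C` into `ᴮC`. -/
@[simps] abbrev triv : C ⥤ LComod B where
  obj X := trivObj B X
  map f := ⟨f, by simp [← whisker_exchange]⟩

instance : (triv B).Monoidal := Functor.CoreMonoidal.toMonoidal
  { εIso := mkIso (Iso.refl (𝟙_ C)) (by simp)
    μIso X Y := mkIso (Iso.refl (X ⊗ Y)) (by
      simpa [tensorObj_coact] using triv_tensor_colinear X Y)
    μIso_hom_natural_left f X := by ext; simp
    μIso_hom_natural_right f X := by ext; simp
    associativity X Y Z := by ext; simp
    left_unitality X := by ext; simp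
    right_unitality X := by ext; simp }

@[simp] lemma triv_μ_hom (X Y : C) : (Functor.LaxMonoidal.μ (triv B) X Y).hom = 𝟙 _ := rfl
@[simp] lemma triv_δ_hom (X Y : C) : (Functor.OplaxMonoidal.δ (triv B) X Y).hom = 𝟙 _ := rfl
@[simp] lemma triv_ε_hom : (Functor.LaxMonoidal.ε (triv B)).hom = 𝟙 _ := rfl

/-- The braiding of `C` as an isomorphism `Xᵗ ⊗ M ≅ M ⊗ Xᵗ` of comodules. -/
def halfBraiding (X : C) (M : LComod B) : (triv B).obj X ⊗ M ≅ M ⊗ (triv B).obj X :=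
  mkIso (β_ X M.X) (braiding_colinear B X M)

@[simp] lemma halfBraiding_hom_hom (X : C) (M : LComod B) :
    (halfBraiding X M).hom.hom = (β_ X M.X).hom := rfl

instance monObjX (M : LComod B) [MonObj M] : MonObj M.X where
  one := (η[M] : 𝟙_ (LComod B) ⟶ M).hom
  mul := (μ[M] : M ⊗ M ⟶ M).hom
  one_mul := congrArg Hom.hom (MonObj.one_mul M)
  mul_one := congrArg Hom.hom (MonObj.mul_one M)
  mul_assoc := congrArg Hom.hom (MonObj.mul_assoc M)

lemma monObjX_one (M : LComod B) [MonObj M] : η[M.X] = (η[M] : 𝟙_ (LComod B) ⟶ M).hom := rfl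
lemma monObjX_mul (M : LComod B) [MonObj M] : μ[M.X] = (μ[M] : M ⊗ M ⟶ M).hom := rfl

lemma mul_str (M : C) [MonObj M] :
    μ[B ⊗ M] = str B M M ≫ B ◁ μ[M] := by
  simp [MonObj.tensorObj.mul_def, str, MonoidalCategory.tensorHom_def]

instance isMonHom_coact (M : LComod B) [MonObj M] : IsMonHom M.coact where
  one_hom := by
    rw [monObjX_one, Hom.colinear, MonObj.tensorObj.one_def]
    simp [MonoidalCategory.tensorHom_def, monObjX_one]
  mul_hom := by
    rw [monObjX_mul, Hom.colinear, mul_str, tensorObj_coact, Category.assoc]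
    rfl

end LComod

open LComod

/-- A `B`-`F`-bicomodule algebra in `C`: an algebra `X` which is a left `B`-comodule and a right
`F`-comodule, such that the two coactions commute and both are algebra morphisms. -/
structure BicomodAlg (B F : C) [BimonObj B] [BimonObj F] where
  X : C
  [mon : MonObj X]
  lcoact : X ⟶ B ⊗ X
  rcoact : X ⟶ X ⊗ F
  lcounit : lcoact ≫ ε[B] ▷ X = (λ_ X).inv
  lcoassoc : lcoact ≫ B ◁ lcoact = lcoact ≫ Δ[B] ▷ X ≫ (α_ B B X).hom
  rcounit : rcoact ≫ X ◁ ε[F] = (ρ_ X).inv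
  rcoassoc : rcoact ≫ rcoact ▷ F = rcoact ≫ X ◁ Δ[F] ≫ (α_ X F F).inv
  bicomod : rcoact ≫ lcoact ▷ F ≫ (α_ B X F).hom = lcoact ≫ B ◁ rcoact
  [isMonHom_lcoact : IsMonHom lcoact]
  [isMonHom_rcoact : IsMonHom rcoact]

namespace BicomodAlg

attribute [instance] mon isMonHom_lcoact isMonHom_rcoact

variable {B F : C} [BimonObj B] [BimonObj F]

/-- Morphisms of bicomodule algebras: algebra morphisms which are left and right colinear. -/
@[ext]
structure Hom (M N : BicomodAlg B F) where
  hom : M.X ⟶ N.X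
  [isMonHom : IsMonHom hom]
  lcolinear : hom ≫ N.lcoact = M.lcoact ≫ B ◁ hom
  rcolinear : hom ≫ N.rcoact = M.rcoact ≫ hom ▷ F

attribute [instance] Hom.isMonHom

instance : Category (BicomodAlg B F) where
  Hom M N := Hom M N
  id M := { hom := 𝟙 M.X, lcolinear := by simp, rcolinear := by simp }
  comp f g :=
    { hom := f.hom ≫ g.hom
      lcolinear := by
        rw [Category.assoc, g.lcolinear, ← Category.assoc, f.lcolinear]; simp
      rcolinear := by
        rw [Category.assoc, g.rcolinear, ← Category.assoc, f.rcolinear]; simp }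

/-- The underlying left comodule. -/
@[simps] abbrev left (M : BicomodAlg B F) : LComod B :=
  ⟨M.X, M.lcoact, M.lcounit, M.lcoassoc⟩

/-- A bicomodule algebra is an algebra in the monoidal category of left comodules. -/
instance (M : BicomodAlg B F) : MonObj M.left where
  one := ⟨η[M.X], by
    rw [IsMonHom.one_hom, MonObj.tensorObj.one_def]
    simp [MonoidalCategory.tensorHom_def]⟩
  mul := ⟨μ[M.X], by
    rw [IsMonHom.mul_hom, mul_str, tensorObj_coact, Category.assoc]⟩
  one_mul := by ext; simp
  mul_one := by ext; simp
  mul_assoc := by ext; simp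

@[simp] lemma left_one_hom (M : BicomodAlg B F) : (η[M.left] : _ ⟶ M.left).hom = η[M.X] := rfl
@[simp] lemma left_mul_hom (M : BicomodAlg B F) : (μ[M.left] : _ ⟶ M.left).hom = μ[M.X] := rfl

/-- The right coaction as a left colinear map `M ⟶ M ⊗ Fᵗ`. -/
@[simps] def rcoactHom (M : BicomodAlg B F) : M.left ⟶ M.left ⊗ (triv B).obj F where
  hom := M.rcoact
  colinear := by
    rw [← M.bicomod, tensorObj_coact, str_trivial_right M.left F]

/-- `B` is a `B`-`B`-bicomodule algebra through its comultiplication. -/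
@[simps] def regular (B : C) [BimonObj B] : BicomodAlg B B where
  X := B
  lcoact := Δ[B]
  rcoact := Δ[B]
  lcounit := by simp
  lcoassoc := by simp
  rcounit := by simp
  rcoassoc := by simp
  bicomod := by simp
  isMonHom_lcoact := ⟨BimonObj.one_comul B, by
    rw [BimonObj.mul_comul, MonObj.tensorObj.mul_def]⟩
  isMonHom_rcoact := ⟨BimonObj.one_comul B, by
    rw [BimonObj.mul_comul, MonObj.tensorObj.mul_def]⟩

end BicomodAlg


section Middle

open Functor

universe v₁ v₂ u₁ u₂

variable {D : Type u₁} [Category.{v₁} D] [MonoidalCategory D]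
variable {E : Type u₂} [Category.{v₂} E] [MonoidalCategory E]

/-- Apply `b : X ⊗ Y ⟶ Y ⊗ X` in the middle of `(W ⊗ X) ⊗ (Y ⊗ Z)`. -/
def mid (W : D) {X Y : D} (Z : D) (b : X ⊗ Y ⟶ Y ⊗ X) : (W ⊗ X) ⊗ (Y ⊗ Z) ⟶ (W ⊗ Y) ⊗ (X ⊗ Z) :=
  (α_ W X (Y ⊗ Z)).hom ≫ (W ◁ (α_ X Y Z).inv) ≫ (W ◁ b ▷ Z) ≫
    (W ◁ (α_ Y X Z).hom) ≫ (α_ W Y (X ⊗ Z)).inv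

lemma mid_natural (W : D) {X X' Y Z Z' : D} (b : X ⊗ Y ⟶ Y ⊗ X) (b' : X' ⊗ Y ⟶ Y ⊗ X')
    (f : X ⟶ X') (g : Z ⟶ Z') (h : f ▷ Y ≫ b' = b ≫ Y ◁ f) :
    (W ◁ f ⊗ₘ Y ◁ g) ≫ mid W Z' b' = mid W Z b ≫ ((W ⊗ Y) ◁ (f ⊗ₘ g)) := by
  calc _ = 𝟙 _ ⊗≫ W ◁ f ▷ Y ▷ Z ⊗≫ W ◁ ((X' ⊗ Y) ◁ g ≫ b' ▷ Z') ⊗≫ 𝟙 _ := by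
        rw [MonoidalCategory.tensorHom_def, mid]
        monoidal
    _ = 𝟙 _ ⊗≫ W ◁ ((f ▷ Y ≫ b') ▷ Z) ⊗≫ W ◁ Y ◁ X' ◁ g ⊗≫ 𝟙 _ := by
        rw [whisker_exchange]
        monoidal
    _ = _ := by
        rw [h, mid, MonoidalCategory.tensorHom_def]
        monoidal

lemma mid_map (F : E ⥤ D) [F.LaxMonoidal] (W X Y Z : E) (b : X ⊗ Y ⟶ Y ⊗ X)
    (b' : F.obj X ⊗ F.obj Y ⟶ F.obj Y ⊗ F.obj X)
    (hb : b' ≫ LaxMonoidal.μ F Y X = LaxMonoidal.μ F X Y ≫ F.map b) :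
    mid (F.obj W) (F.obj Z) b' ≫ (LaxMonoidal.μ F W Y ⊗ₘ LaxMonoidal.μ F X Z) ≫ LaxMonoidal.μ F (W ⊗ Y) (X ⊗ Z) =
      (LaxMonoidal.μ F W X ⊗ₘ LaxMonoidal.μ F Y Z) ≫ LaxMonoidal.μ F (W ⊗ X) (Y ⊗ Z) ≫ F.map (mid W Z b) := by
  rw [MonoidalCategory.tensorHom_def]
  simp only [mid, Category.assoc]
  rw [LaxMonoidal.whiskerLeft_μ_comp_μ,
    associator_inv_naturality_left_assoc, ← pentagon_inv_assoc,
    ← comp_whiskerRight_assoc, ← comp_whiskerRight_assoc, Category.assoc, LaxMonoidal.μ_whiskerRight_comp_μ,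
    whiskerLeft_hom_inv_assoc, Iso.inv_hom_id_assoc, comp_whiskerRight_assoc,
    comp_whiskerRight_assoc, LaxMonoidal.μ_natural_left_assoc, associator_inv_naturality_middle_assoc,
    ← comp_whiskerRight_assoc, ← comp_whiskerRight_assoc, ← MonoidalCategory.whiskerLeft_comp,
    hb,
    MonoidalCategory.whiskerLeft_comp_assoc, LaxMonoidal.μ_natural_right, LaxMonoidal.whiskerLeft_μ_comp_μ_assoc,
    comp_whiskerRight_assoc, comp_whiskerRight_assoc, comp_whiskerRight_assoc,
    comp_whiskerRight_assoc, pentagon_inv_assoc, LaxMonoidal.μ_natural_left_assoc, LaxMonoidal.μ_natural_left_assoc,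
    Iso.hom_inv_id_assoc, ← associator_inv_naturality_left_assoc, LaxMonoidal.μ_whiskerRight_comp_μ_assoc,
    Iso.inv_hom_id_assoc, ← MonoidalCategory.tensorHom_def_assoc]
  simp only [← Functor.map_comp, whisker_assoc, Category.assoc, pentagon_inv_inv_hom_hom_inv,
    pentagon_inv_hom_hom_hom_inv_assoc]

/-! Coactions of `T F` transported along a monoidal functor `α` with `T ⋙ α ≅ T'`. -/

universe v₃ u₃

variable {G : Type u₃} [Category.{v₃} G] [MonoidalCategory G]
variable {T : G ⥤ E} [T.Monoidal] {T' : G ⥤ D} [T'.Monoidal] {α : E ⥤ D} [α.Monoidal]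
variable (τ : T ⋙ α ≅ T') [NatTrans.IsMonoidal τ.hom]

/-- `α(M ⊗ T X) ≅ α(M) ⊗ α(T X) ≅ α(M) ⊗ T' X`. -/
def thetaIso (M : E) (X : G) : α.obj (M ⊗ T.obj X) ≅ α.obj M ⊗ T'.obj X :=
  (Functor.Monoidal.μIso α M (T.obj X)).symm ≪≫ whiskerLeftIso _ (τ.app X)

lemma thetaIso_hom (M : E) (X : G) :
    (thetaIso τ M X).hom = OplaxMonoidal.δ α M (T.obj X) ≫ α.obj M ◁ τ.hom.app X := rfl

lemma tau_tensor (X Y : G) :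
    LaxMonoidal.μ α (T.obj X) (T.obj Y) ≫ α.map (LaxMonoidal.μ T X Y) ≫ τ.hom.app (X ⊗ Y) =
      (τ.hom.app X ⊗ₘ τ.hom.app Y) ≫ LaxMonoidal.μ T' X Y := by
  have := NatTrans.IsMonoidal.tensor (τ := τ.hom) X Y
  simpa only [LaxMonoidal.comp_μ, Category.assoc] using this

lemma tau_tensor' (X Y : G) :
    τ.hom.app (X ⊗ Y) ≫ OplaxMonoidal.δ T' X Y =
      α.map (OplaxMonoidal.δ T X Y) ≫ OplaxMonoidal.δ α (T.obj X) (T.obj Y) ≫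
          (τ.hom.app X ⊗ₘ τ.hom.app Y) := by
  have h2 := tau_tensor τ X Y =≫ OplaxMonoidal.δ T' X Y
  simp only [Category.assoc, Functor.Monoidal.μ_δ] at h2
  rw [Category.comp_id] at h2
  rw [← h2, Functor.Monoidal.δ_μ_assoc, Functor.Monoidal.map_δ_μ_assoc]

lemma tau_unit :
    LaxMonoidal.ε α ≫ α.map (LaxMonoidal.ε T) ≫ τ.hom.app (𝟙_ G) = LaxMonoidal.ε T' := by
  have := NatTrans.IsMonoidal.unit (τ := τ.hom)
  simpa only [LaxMonoidal.comp_ε, Category.assoc] using this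

lemma tau_natural {X Y : G} (f : X ⟶ Y) :
    α.map (T.map f) ≫ τ.hom.app Y = τ.hom.app X ≫ T'.map f :=
  τ.hom.naturality f

variable {M : E} {F : G} (χ : M ⟶ M ⊗ T.obj F)

/-- The transported coaction. -/
def transCoact : α.obj M ⟶ α.obj M ⊗ T'.obj F := α.map χ ≫ (thetaIso τ M F).hom

lemma transCoact_counit [ComonObj F]
    (h : χ ≫ M ◁ T.map ε[F] = (ρ_ M).inv ≫ M ◁ LaxMonoidal.ε T) :
    transCoact τ χ ≫ α.obj M ◁ T'.map ε[F] =
      (ρ_ (α.obj M)).inv ≫ α.obj M ◁ LaxMonoidal.ε T' := by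
  rw [transCoact, thetaIso_hom, Category.assoc, Category.assoc,
    ← MonoidalCategory.whiskerLeft_comp, ← tau_natural, MonoidalCategory.whiskerLeft_comp,
    OplaxMonoidal.δ_natural_right_assoc, ← Functor.map_comp_assoc, h,
    Functor.map_comp_assoc, ← OplaxMonoidal.δ_natural_right_assoc α, ← tau_unit τ,
    Functor.Monoidal.map_rightUnitor_inv]
  simp only [Category.assoc, MonoidalCategory.whiskerLeft_comp, Functor.Monoidal.μ_δ_assoc]

lemma transCoact_coassoc [ComonObj F]
    (h : χ ≫ χ ▷ T.obj F = χ ≫ M ◁ (T.map Δ[F] ≫ OplaxMonoidal.δ T F F) ≫ (α_ _ _ _).inv) :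
    transCoact τ χ ≫ transCoact τ χ ▷ T'.obj F =
      transCoact τ χ ≫ α.obj M ◁ (T'.map Δ[F] ≫ OplaxMonoidal.δ T' F F) ≫ (α_ _ _ _).inv := by
  have e1 : transCoact τ χ ≫ transCoact τ χ ▷ T'.obj F =
      α.map (χ ≫ χ ▷ T.obj F) ≫ OplaxMonoidal.δ α (M ⊗ T.obj F) (T.obj F) ≫
          OplaxMonoidal.δ α M (T.obj F) ▷ α.obj (T.obj F) ≫
            (α.obj M ◁ τ.hom.app F ⊗ₘ τ.hom.app F) := by
    rw [transCoact, thetaIso_hom, Functor.map_comp_assoc, ← OplaxMonoidal.δ_natural_left_assoc]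
    simp only [comp_whiskerRight, Category.assoc, tensorHom_def']
    rw [whisker_exchange_assoc, whisker_exchange_assoc]
  have e2 : transCoact τ χ ≫ α.obj M ◁ (T'.map Δ[F] ≫ OplaxMonoidal.δ T' F F) =
      α.map (χ ≫ M ◁ (T.map Δ[F] ≫ OplaxMonoidal.δ T F F)) ≫
        OplaxMonoidal.δ α M (T.obj F ⊗ T.obj F) ≫
          α.obj M ◁ (OplaxMonoidal.δ α (T.obj F) (T.obj F) ≫ (τ.hom.app F ⊗ₘ τ.hom.app F)) := by
    rw [transCoact, thetaIso_hom, Category.assoc, Category.assoc,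
      ← MonoidalCategory.whiskerLeft_comp, ← Category.assoc (τ.hom.app F), ← tau_natural,
      Category.assoc, tau_tensor', Functor.map_comp_assoc, ← OplaxMonoidal.δ_natural_right_assoc]
    simp only [MonoidalCategory.whiskerLeft_comp, Functor.map_comp, Category.assoc]
  have e3 := reassoc_of% e2
  rw [e3, e1, h, ← Category.assoc χ, Functor.map_comp_assoc,
    ← OplaxMonoidal.associativity_inv_assoc]
  have e4 (t : α.obj (T.obj F) ⟶ T'.obj F) : (α_ _ _ _).inv ≫ (α.obj M ◁ t ⊗ₘ t) =
      α.obj M ◁ (t ⊗ₘ t) ≫ (α_ _ _ _).inv := by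
    rw [← id_tensorHom, ← id_tensorHom, associator_inv_naturality]
  rw [e4 (τ.hom.app F)]
  simp only [MonoidalCategory.whiskerLeft_comp, Category.assoc]

lemma transCoact_one [MonObj M] [MonObj F]
    (h : η[M] ≫ χ = (λ_ (𝟙_ _)).inv ≫ (η[M] ⊗ₘ (LaxMonoidal.ε T ≫ T.map η[F]))) :
    (LaxMonoidal.ε α ≫ α.map η[M]) ≫ transCoact τ χ = (λ_ (𝟙_ _)).inv ≫
        (LaxMonoidal.ε α ≫ α.map η[M] ⊗ₘ (LaxMonoidal.ε T' ≫ T'.map η[F])) := by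
  have e : LaxMonoidal.ε T' ≫ T'.map η[F] =
      LaxMonoidal.ε α ≫ α.map (LaxMonoidal.ε T ≫ T.map η[F]) ≫ τ.hom.app F := by
    rw [← tau_unit τ, Functor.map_comp]
    simp only [Category.assoc, tau_natural]
  rw [transCoact, thetaIso_hom, Category.assoc, ← Functor.map_comp_assoc α, h, e]
  rw [Functor.map_comp_assoc, ← OplaxMonoidal.δ_natural_assoc, Functor.Monoidal.map_leftUnitor_inv]
  simp only [Category.assoc, Functor.Monoidal.μ_δ_assoc]
  have e' (t : α.obj (T.obj F) ⟶ T'.obj F) (s : α.obj (𝟙_ E) ⟶ α.obj (T.obj F)) :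
      LaxMonoidal.ε α ≫ (λ_ _).inv ≫ LaxMonoidal.ε α ▷ _ ≫ (α.map η[M] ⊗ₘ s) ≫ α.obj M ◁ t =
        (λ_ (𝟙_ _)).inv ≫ (LaxMonoidal.ε α ≫ α.map η[M] ⊗ₘ LaxMonoidal.ε α ≫ s ≫ t) := by
    rw [leftUnitor_inv_naturality_assoc, ← id_tensorHom, ← id_tensorHom, ← tensorHom_id]
    simp only [tensorHom_comp_tensorHom, tensorHom_comp_tensorHom_assoc, Category.id_comp,
      Category.comp_id]
  exact e' _ _

lemma transCoact_mul [MonObj M] [MonObj F] (b : T.obj F ⊗ M ⟶ M ⊗ T.obj F)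
    (b' : T'.obj F ⊗ α.obj M ⟶ α.obj M ⊗ T'.obj F)
    (hb : τ.hom.app F ▷ α.obj M ≫ b' = (LaxMonoidal.μ α (T.obj F) M ≫ α.map b ≫
      OplaxMonoidal.δ α M (T.obj F)) ≫ α.obj M ◁ τ.hom.app F)
    (h : μ[M] ≫ χ = (χ ⊗ₘ χ) ≫ mid M (T.obj F) b ≫ (μ[M] ⊗ₘ (LaxMonoidal.μ T F F ≫ T.map μ[F]))) :
    (LaxMonoidal.μ α _ _ ≫ α.map μ[M]) ≫ transCoact τ χ =
      (transCoact τ χ ⊗ₘ transCoact τ χ) ≫ mid (α.obj M) (T'.obj F) b' ≫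
        ((LaxMonoidal.μ α _ _ ≫ α.map μ[M]) ⊗ₘ (LaxMonoidal.μ T' F F ≫ T'.map μ[F])) := by
  set c := LaxMonoidal.μ α (T.obj F) M ≫ α.map b ≫ OplaxMonoidal.δ α M (T.obj F) with hc
  have h1 := mid_map α M (T.obj F) M (T.obj F) b c (by simp [hc])
  have h2 := mid_natural (α.obj M) c b' (τ.hom.app F) (τ.hom.app F) hb
  have e : LaxMonoidal.μ α _ _ ≫ α.map (LaxMonoidal.μ T F F ≫ T.map μ[F]) ≫
      τ.hom.app F = (τ.hom.app F ⊗ₘ τ.hom.app F) ≫ LaxMonoidal.μ T' F F ≫ T'.map μ[F] := by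
    rw [← Category.assoc (_ ⊗ₘ _), ← tau_tensor, Functor.map_comp]
    simp only [Category.assoc, tau_natural]
  rw [transCoact, thetaIso_hom, Category.assoc, ← Functor.map_comp_assoc α, h,
    Functor.map_comp_assoc, ← LaxMonoidal.μ_natural_assoc, Functor.map_comp_assoc,
    ← OplaxMonoidal.δ_natural_assoc]
  have h1' : LaxMonoidal.μ α _ _ ≫ α.map (mid M (T.obj F) b) ≫ OplaxMonoidal.δ α _ _ =
      (OplaxMonoidal.δ α M (T.obj F) ⊗ₘ OplaxMonoidal.δ α M (T.obj F)) ≫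
        mid (α.obj M) (α.obj (T.obj F)) c ≫
          (LaxMonoidal.μ α M M ⊗ₘ LaxMonoidal.μ α (T.obj F) (T.obj F)) := by
    have h3 := (OplaxMonoidal.δ α M (T.obj F) ⊗ₘ OplaxMonoidal.δ α M (T.obj F)) ≫= h1 =≫
      OplaxMonoidal.δ α _ _
    simp only [Category.assoc, Functor.Monoidal.μ_δ, tensorHom_comp_tensorHom_assoc,
      Functor.Monoidal.δ_μ, id_tensorHom_id, Category.id_comp, Category.comp_id] at h3
    exact h3.symm
  rw [reassoc_of% h1', ← tensorHom_comp_tensorHom_assoc, ← tensorHom_comp_tensorHom_assoc]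
  have h2' := reassoc_of% h2
  refine congrArg _ (congrArg _ (Eq.trans ?_ (h2' _).symm))
  refine congrArg _ ?_
  rw [← id_tensorHom, ← id_tensorHom, tensorHom_comp_tensorHom, tensorHom_comp_tensorHom]
  rw [Category.comp_id]
  refine (congrArg (fun t => (LaxMonoidal.μ α M M ≫ α.map μ[M]) ⊗ₘ t) e).trans ?_
  refine Eq.trans ?_ (tensorHom_comp_tensorHom _ _ _ _).symm
  rw [Category.id_comp]

end Middle

section Functors

open Functor

variable {B L : C} [BimonObj B] [BimonObj L] (α : LComod B ⥤ LComod L) [α.Monoidal]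

/-- `α` is trivializable on `C`: a monoidal isomorphism between the restriction of `α` along
`X ↦ Xᵗ` and the embedding of `C` into `ᴸC`. -/
structure Trivialization where
  iso : triv B ⋙ α ≅ triv L
  [isMonoidal : NatTrans.IsMonoidal iso.hom]

attribute [instance] Trivialization.isMonoidal

/-- The condition `(𝔸)`: the monoidal structure of `α` is compatible with the braidings
`Xᵗ ⊗ M ⟶ M ⊗ Xᵗ`, as morphisms of `C`. -/
def ConditionA : Prop :=
  ∀ (X : C) (M : LComod B),
    (β_ (α.obj ((triv B).obj X)).X (α.obj M).X).hom ≫ (LaxMonoidal.μ α M ((triv B).obj X)).hom =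
      (LaxMonoidal.μ α ((triv B).obj X) M).hom ≫ (α.map (halfBraiding X M).hom).hom

variable {α} (τ : Trivialization α)

namespace Trivialization

variable {F : C} [BimonObj F]

/-- `θ_{M,X} : α(M ⊗ Xᵗ) ≅ α(M) ⊗ α(Xᵗ) ≅ α(M) ⊗ Xᵗ`. -/
def theta (M : LComod B) (X : C) :
    α.obj (M ⊗ (triv B).obj X) ≅ α.obj M ⊗ (triv L).obj X :=
  thetaIso τ.iso M X

/-- The right coaction `α(M) ⟶ α(M ⊗ Fᵗ) ⟶ α(M) ⊗ Fᵗ`, left colinear. -/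
def coactHom (M : BicomodAlg B F) : α.obj M.left ⟶ α.obj M.left ⊗ (triv L).obj F :=
  α.map M.rcoactHom ≫ (τ.theta M.left F).hom

lemma rcoassoc_left (M : BicomodAlg B F) :
    M.rcoactHom ≫ M.rcoactHom ▷ (triv B).obj F =
      M.rcoactHom ≫ M.left ◁ ((triv B).map Δ[F] ≫ OplaxMonoidal.δ (triv B) F F) ≫ (α_ _ _ _).inv := by
  ext
  simpa using M.rcoassoc

lemma rcounit_left (M : BicomodAlg B F) :
    M.rcoactHom ≫ M.left ◁ ((triv B).map ε[F]) = (ρ_ M.left).inv ≫ M.left ◁ LaxMonoidal.ε (triv B) := by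
  ext
  simpa using M.rcounit

lemma mul_left (M : BicomodAlg B F) :
    μ[M.left] ≫ M.rcoactHom = (M.rcoactHom ⊗ₘ M.rcoactHom) ≫
      mid M.left ((triv B).obj F) (halfBraiding F M.left).hom ≫
        (μ[M.left] ⊗ₘ (LaxMonoidal.μ (triv B) F F ≫ (triv B).map μ[F])) := by
  ext
  simp [mid, MonObj.tensorObj.mul_def, tensorμ]

lemma one_left (M : BicomodAlg B F) :
    η[M.left] ≫ M.rcoactHom = (λ_ (𝟙_ _)).inv ≫
        (η[M.left] ⊗ₘ (LaxMonoidal.ε (triv B) ≫ (triv B).map η[F])) := by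
  ext
  simp [MonObj.tensorObj.one_def]

/-- Compatibility of `τ` and the half braidings under `(𝔸)`. -/
lemma tau_halfBraiding (hA : ConditionA α) (X : C) (M : LComod B) :
    τ.iso.hom.app X ▷ α.obj M ≫ (halfBraiding X (α.obj M)).hom =
      (LaxMonoidal.μ α ((triv B).obj X) M ≫ α.map (halfBraiding X M).hom ≫
        OplaxMonoidal.δ α M ((triv B).obj X)) ≫ α.obj M ◁ τ.iso.hom.app X := by
  have h : (halfBraiding X M).hom.hom = _ := rfl
  apply LComod.Hom.ext
  have h' : (LaxMonoidal.μ α M ((triv B).obj X)).hom ≫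
    (OplaxMonoidal.δ α M ((triv B).obj X)).hom = 𝟙 _ :=
      congrArg LComod.Hom.hom (Functor.Monoidal.μ_δ α M ((triv B).obj X))
  have h2 := hA X M =≫ (OplaxMonoidal.δ α M ((triv B).obj X)).hom
  rw [Category.assoc, h', Category.assoc] at h2
  have h3 : (β_ (α.obj ((triv B).obj X)).X (α.obj M).X).hom =
    (LaxMonoidal.μ α ((triv B).obj X) M ≫ α.map (halfBraiding X M).hom ≫
        OplaxMonoidal.δ α M ((triv B).obj X)).hom := (Category.comp_id _).symm.trans h2
  refine Eq.trans ?_ (congrArg (· ≫ (α.obj M).X ◁ (τ.iso.hom.app X).hom) h3)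
  exact (braiding_naturality_left (τ.iso.hom.app X).hom (α.obj M).X)

/-- For a `B`-`F`-bicomodule algebra `M`, the `L`-`F`-bicomodule algebra `α(M)`. The algebra
structure is `α(M) ⊗ α(M) ⟶ α(M ⊗ M) ⟶ α(M)`, `I ⟶ α(I) ⟶ α(M)`, the left coaction is the one
of the left `L`-comodule `α(M)` and the right coaction is `α(M) ⟶ α(M ⊗ Fᵗ) ⟶ α(M) ⊗ F`. -/
def image (hA : ConditionA α) (M : BicomodAlg B F) : BicomodAlg L F :=
  letI : MonObj (α.obj M.left) := α.monObjObj M.left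
  { X := (α.obj M.left).X
    mon :=  monObjX (α.obj M.left)
    lcoact := (α.obj M.left).coact
    rcoact := (τ.coactHom M).hom
    lcounit := (α.obj M.left).counit
    lcoassoc := (α.obj M.left).coassoc
    rcounit := by
      have := congrArg LComod.Hom.hom (transCoact_counit τ.iso M.rcoactHom (rcounit_left M))
      refine this.trans ?_
      change (ρ_ (α.obj M.left).X).inv ≫ (α.obj M.left).X ◁ 𝟙 (𝟙_ C) = _
      simp
    rcoassoc := by
      have := congrArg LComod.Hom.hom (transCoact_coassoc τ.iso M.rcoactHom (rcoassoc_left M))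
      refine this.trans ?_
      change (τ.coactHom M).hom ≫ (α.obj M.left).X ◁ (Δ[F] ≫ 𝟙 _) ≫ (α_ _ F F).inv = _
      rw [Category.comp_id]
    bicomod := by
      have := (τ.coactHom M).colinear
      rw [tensorObj_coact, str_trivial_right] at this
      exact this
    isMonHom_lcoact := isMonHom_coact (α.obj M.left)
    isMonHom_rcoact := 
      { one_hom := by
          have := congrArg LComod.Hom.hom (transCoact_one τ.iso M.rcoactHom (one_left M))
          refine this.trans ?_
          rw [MonObj.tensorObj.one_def]
          exact congrArg (fun t => (λ_ (𝟙_ C)).inv ≫ (η[(α.obj M.left).X] ⊗ₘ t))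
            (Category.id_comp η[F])
        mul_hom := by
          have := congrArg LComod.Hom.hom (transCoact_mul τ.iso M.rcoactHom _ _
            (τ.tau_halfBraiding hA F M.left) (mul_left M))
          refine this.trans ?_
          rw [MonObj.tensorObj.mul_def]
          exact congrArg (fun t => ((τ.coactHom M).hom ⊗ₘ (τ.coactHom M).hom) ≫
            tensorμ _ _ _ _ ≫ (μ[(α.obj M.left).X] ⊗ₘ t)) (Category.id_comp μ[F]) } }

end Trivialization
end Functors

section Cotensor

/-- An object is flat if tensoring with it preserves equalizers. (Since `C` is braided, this does
not depend on the side.) -/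
class Flat (X : C) : Prop where
  preservesEqualizers : PreservesLimitsOfShape WalkingParallelPair (tensorLeft X)

attribute [instance] Flat.preservesEqualizers

instance (X : C) [Flat X] : PreservesLimitsOfShape WalkingParallelPair (tensorRight X) :=
  preservesLimitsOfShape_of_natIso (BraidedCategory.tensorLeftIsoTensorRight X)

variable [HasEqualizers C]

lemma mono_map_ι {P Q : C} (f g : P ⟶ Q) (G : C ⥤ C)
    [PreservesLimitsOfShape WalkingParallelPair G] : Mono (G.map (equalizer.ι f g)) :=
  mono_of_isLimit_fork (isLimitOfHasEqualizerOfPreservesLimit G f g)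

/-- Lift a map through `G(eq(f,g)) ⟶ G(P)` for a functor `G` preserving equalizers. -/
noncomputable def liftMap {P Q Z : C} (f g : P ⟶ Q) (G : C ⥤ C)
    [PreservesLimitsOfShape WalkingParallelPair G] (k : Z ⟶ G.obj P)
    (h : k ≫ G.map f = k ≫ G.map g) : Z ⟶ G.obj (equalizer f g) :=
  Fork.IsLimit.lift (isLimitOfHasEqualizerOfPreservesLimit G f g) k h

lemma liftMap_ι {P Q Z : C} (f g : P ⟶ Q) (G : C ⥤ C)
    [PreservesLimitsOfShape WalkingParallelPair G] (k : Z ⟶ G.obj P)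
    (h : k ≫ G.map f = k ≫ G.map g) : liftMap f g G k h ≫ G.map (equalizer.ι f g) = k :=
  Fork.IsLimit.lift_ι' (isLimitOfHasEqualizerOfPreservesLimit G f g) k h

lemma isMonHom_of_comp_mono {P Q R : C} [MonObj P] [MonObj Q] [MonObj R] (f : P ⟶ Q) (g : Q ⟶ R)
    [IsMonHom (f ≫ g)] [IsMonHom g] [Mono g] : IsMonHom f where
  one_hom := by
    rw [← cancel_mono g, Category.assoc, IsMonHom.one_hom, IsMonHom.one_hom]
  mul_hom := by
    rw [← cancel_mono g, Category.assoc, IsMonHom.mul_hom, Category.assoc, IsMonHom.mul_hom,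
      tensorHom_comp_tensorHom_assoc]

/-- The algebra structure on a subobject closed under unit and multiplication. -/
abbrev monObjOfMono {X P : C} [MonObj P] (i : X ⟶ P) [Mono i] (e : 𝟙_ C ⟶ X) (m : X ⊗ X ⟶ X)
    (he : e ≫ i = η[P]) (hm : m ≫ i = (i ⊗ₘ i) ≫ μ[P]) : MonObj X where
  one := e
  mul := m
  one_mul := by
    rw [← cancel_mono i, Category.assoc, hm, ← tensorHom_id, tensorHom_comp_tensorHom_assoc, he,
      Category.id_comp]
    simp [MonoidalCategory.tensorHom_def']
  mul_one := by
    rw [← cancel_mono i, Category.assoc, hm, ← id_tensorHom, tensorHom_comp_tensorHom_assoc, he,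
      Category.id_comp]
    simp [MonoidalCategory.tensorHom_def]
  mul_assoc := by
    rw [← cancel_mono i]
    simp only [Category.assoc, hm]
    rw [← tensorHom_id, ← id_tensorHom, tensorHom_comp_tensorHom_assoc,
      tensorHom_comp_tensorHom_assoc, hm, Category.id_comp]
    have e1 : ((i ⊗ₘ i) ≫ μ[P]) ⊗ₘ i = ((i ⊗ₘ i) ⊗ₘ i) ≫ μ[P] ▷ P := by
      rw [← tensorHom_id, tensorHom_comp_tensorHom, Category.comp_id]
    have e2 : i ⊗ₘ ((i ⊗ₘ i) ≫ μ[P]) = (i ⊗ₘ (i ⊗ₘ i)) ≫ P ◁ μ[P] := by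
      rw [← id_tensorHom, tensorHom_comp_tensorHom, Category.comp_id]
    rw [e1, e2, Category.assoc, Category.assoc, MonObj.mul_assoc, associator_naturality_assoc]

/-- The equalizer of two algebra morphisms is a subalgebra. -/
noncomputable abbrev equalizerMon {P Q : C} [MonObj P] [MonObj Q] (f g : P ⟶ Q)
    [IsMonHom f] [IsMonHom g] : MonObj (equalizer f g) :=
  monObjOfMono (equalizer.ι f g)
    (equalizer.lift η[P] (by rw [IsMonHom.one_hom, IsMonHom.one_hom]))
    (equalizer.lift ((equalizer.ι f g ⊗ₘ equalizer.ι f g) ≫ μ[P]) (by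
      rw [Category.assoc, IsMonHom.mul_hom, tensorHom_comp_tensorHom_assoc, equalizer.condition,
        Category.assoc, IsMonHom.mul_hom, tensorHom_comp_tensorHom_assoc]))
    (equalizer.lift_ι _ _) (equalizer.lift_ι _ _)

lemma isMonHom_ι {P Q : C} [MonObj P] [MonObj Q] (f g : P ⟶ Q) [IsMonHom f] [IsMonHom g] :
    letI := equalizerMon f g
    IsMonHom (equalizer.ι f g) :=
  letI := equalizerMon f g
  { one_hom := equalizer.lift_ι _ _
    mul_hom := equalizer.lift_ι _ _ }

namespace BicomodAlg

variable {L B F : C} [BimonObj L] [BimonObj B] [BimonObj F] (A : BicomodAlg L B) (M : BicomodAlg B F)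

/-- `χ⁺_A ⊗ M : A ⊗ M ⟶ A ⊗ B ⊗ M`. -/
abbrev cotensorFst : A.X ⊗ M.X ⟶ (A.X ⊗ B) ⊗ M.X := A.rcoact ▷ M.X

/-- `A ⊗ χ⁻_M : A ⊗ M ⟶ A ⊗ B ⊗ M`. -/
abbrev cotensorSnd : A.X ⊗ M.X ⟶ (A.X ⊗ B) ⊗ M.X := A.X ◁ M.lcoact ≫ (α_ A.X B M.X).inv

/-- The cotensor product `A □_B M`, the equalizer of `χ⁺_A ⊗ M` and `A ⊗ χ⁻_M`. -/
noncomputable abbrev cotensorX : C := equalizer (cotensorFst A M) (cotensorSnd A M)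

/-- The canonical monomorphism `A □_B M ⟶ A ⊗ M`. -/
noncomputable abbrev cotensorι : cotensorX A M ⟶ A.X ⊗ M.X :=
  equalizer.ι (cotensorFst A M) (cotensorSnd A M)

/-- The left coaction on `A □_B M`, the restriction of `χ⁻_A ⊗ M`. -/
noncomputable def cotensorL [Flat L] : cotensorX A M ⟶ L ⊗ cotensorX A M :=
  liftMap _ _ (tensorLeft L) (cotensorι A M ≫ A.lcoact ▷ M.X ≫ (α_ L A.X M.X).hom) (by
    change _ ≫ L ◁ cotensorFst A M = _ ≫ L ◁ cotensorSnd A M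
    have h := equalizer.condition (cotensorFst A M) (cotensorSnd A M)
    have e1 : (A.lcoact ▷ M.X ≫ (α_ L A.X M.X).hom) ≫ L ◁ cotensorFst A M =
        cotensorFst A M ≫ (A.lcoact ▷ B ≫ (α_ L A.X B).hom) ▷ M.X ≫ (α_ L (A.X ⊗ B) M.X).hom := by
      rw [← comp_whiskerRight_assoc, A.bicomod]
      simp
    have e2 : (A.lcoact ▷ M.X ≫ (α_ L A.X M.X).hom) ≫ L ◁ cotensorSnd A M =
        cotensorSnd A M ≫ (A.lcoact ▷ B ≫ (α_ L A.X B).hom) ▷ M.X ≫ (α_ L (A.X ⊗ B) M.X).hom := by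
      simp only [cotensorSnd, comp_whiskerRight, MonoidalCategory.whiskerLeft_comp, Category.assoc]
      rw [← associator_inv_naturality_left_assoc, whisker_exchange_assoc]
      simp
    rw [Category.assoc, e1, Category.assoc, e2, reassoc_of% h]
    simp only [cotensorι, cotensorSnd, Category.assoc])

/-- The right coaction on `A □_B M`, the restriction of `A ⊗ χ⁺_M`. -/
noncomputable def cotensorR [Flat F] : cotensorX A M ⟶ cotensorX A M ⊗ F :=
  liftMap _ _ (tensorRight F) (cotensorι A M ≫ A.X ◁ M.rcoact ≫ (α_ A.X M.X F).inv) (by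
    change _ ≫ cotensorFst A M ▷ F = _ ≫ cotensorSnd A M ▷ F
    have h := equalizer.condition (cotensorFst A M) (cotensorSnd A M)
    have e1 : (A.X ◁ M.rcoact ≫ (α_ A.X M.X F).inv) ≫ cotensorFst A M ▷ F =
        cotensorFst A M ≫ (A.X ⊗ B) ◁ M.rcoact ≫ (α_ _ M.X F).inv := by
      simp only [cotensorFst, Category.assoc]
      rw [← associator_inv_naturality_left, whisker_exchange_assoc]
    have e2 : (A.X ◁ M.rcoact ≫ (α_ A.X M.X F).inv) ≫ cotensorSnd A M ▷ F =
        cotensorSnd A M ≫ (A.X ⊗ B) ◁ M.rcoact ≫ (α_ _ M.X F).inv := by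
      have hb := congrArg (fun t => A.X ◁ t) M.bicomod
      simp only [MonoidalCategory.whiskerLeft_comp] at hb
      simp [← reassoc_of% hb]
    rw [Category.assoc, e1, Category.assoc, e2, reassoc_of% h]
    simp only [cotensorι, cotensorSnd, Category.assoc])

lemma cotensorL_ι [Flat L] : cotensorL A M ≫ L ◁ cotensorι A M =
    cotensorι A M ≫ A.lcoact ▷ M.X ≫ (α_ L A.X M.X).hom :=
  liftMap_ι _ _ (tensorLeft L) _ _

lemma cotensorR_ι [Flat F] : cotensorR A M ≫ cotensorι A M ▷ F =
    cotensorι A M ≫ A.X ◁ M.rcoact ≫ (α_ A.X M.X F).inv :=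
  liftMap_ι _ _ (tensorRight F) _ _

/-- The `L`-`F`-bicomodule algebra `A □_B M`, a subobject of `A ⊗ M`. -/
noncomputable def cotensor [Flat L] [Flat F] : BicomodAlg L F where
  X := cotensorX A M
  mon := equalizerMon (cotensorFst A M) (cotensorSnd A M)
  lcoact := cotensorL A M
  rcoact := cotensorR A M
  lcounit := by
    have : Mono (𝟙_ C ◁ cotensorι A M) := by rw [id_whiskerLeft]; infer_instance
    rw [← cancel_mono (𝟙_ C ◁ cotensorι A M), Category.assoc, ← whisker_exchange, reassoc_of% (cotensorL_ι A M),
      ← associator_naturality_left, ← comp_whiskerRight_assoc, A.lcounit]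
    simp
  lcoassoc := by
    have : Mono (L ◁ L ◁ cotensorι A M) := mono_map_ι _ _ (tensorLeft L ⋙ tensorLeft L)
    have e1 := congrArg (fun t => t ▷ M.X) A.lcoassoc
    simp only [comp_whiskerRight] at e1
    have h1 : (cotensorL A M ≫ L ◁ cotensorL A M) ≫ L ◁ L ◁ cotensorι A M =
        cotensorι A M ≫ A.lcoact ▷ M.X ≫ (L ◁ A.lcoact) ▷ M.X ≫ (α_ L (L ⊗ A.X) M.X).hom ≫
          L ◁ (α_ L A.X M.X).hom := by
      rw [Category.assoc, ← MonoidalCategory.whiskerLeft_comp, cotensorL_ι,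
        MonoidalCategory.whiskerLeft_comp, reassoc_of% (cotensorL_ι A M)]
      simp
    have h2 : (cotensorL A M ≫ Δ[L] ▷ cotensorX A M ≫ (α_ L L _).hom) ≫ L ◁ L ◁ cotensorι A M =
        cotensorι A M ≫ A.lcoact ▷ M.X ≫ Δ[L] ▷ A.X ▷ M.X ≫ (α_ L L A.X).hom ▷ M.X ≫
          (α_ L (L ⊗ A.X) M.X).hom ≫ L ◁ (α_ L A.X M.X).hom := by
      rw [Category.assoc, Category.assoc, ← associator_naturality_right, ← whisker_exchange_assoc,
        reassoc_of% (cotensorL_ι A M)]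
      simp
    rw [← cancel_mono (L ◁ L ◁ cotensorι A M), h1, h2, reassoc_of% e1]
  rcounit := by
    have : Mono (cotensorι A M ▷ 𝟙_ C) := by rw [whiskerRight_id]; infer_instance
    rw [← cancel_mono (cotensorι A M ▷ 𝟙_ C), Category.assoc, whisker_exchange, reassoc_of% (cotensorR_ι A M),
      ← associator_inv_naturality_right, ← MonoidalCategory.whiskerLeft_comp_assoc, M.rcounit]
    simp
  rcoassoc := by
    have : Mono (cotensorι A M ▷ F ▷ F) := mono_map_ι _ _ (tensorRight F ⋙ tensorRight F)
    have e1 := congrArg (fun t => A.X ◁ t) M.rcoassoc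
    simp only [MonoidalCategory.whiskerLeft_comp] at e1
    have h1 : (cotensorR A M ≫ cotensorR A M ▷ F) ≫ cotensorι A M ▷ F ▷ F =
        cotensorι A M ≫ A.X ◁ M.rcoact ≫ A.X ◁ M.rcoact ▷ F ≫ (α_ A.X (M.X ⊗ F) F).inv ≫
          (α_ A.X M.X F).inv ▷ F := by
      rw [Category.assoc, ← comp_whiskerRight, cotensorR_ι, comp_whiskerRight, reassoc_of% (cotensorR_ι A M)]
      simp
    have h2 : (cotensorR A M ≫ cotensorX A M ◁ Δ[F] ≫ (α_ _ F F).inv) ≫ cotensorι A M ▷ F ▷ F =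
        cotensorι A M ≫ A.X ◁ M.rcoact ≫ A.X ◁ M.X ◁ Δ[F] ≫ A.X ◁ (α_ M.X F F).inv ≫
          (α_ A.X (M.X ⊗ F) F).inv ≫ (α_ A.X M.X F).inv ▷ F := by
      rw [Category.assoc, Category.assoc, ← associator_inv_naturality_left, whisker_exchange_assoc,
        reassoc_of% (cotensorR_ι A M)]
      simp
    rw [← cancel_mono (cotensorι A M ▷ F ▷ F), h1, h2, reassoc_of% e1]
  bicomod := by
    have : Mono (L ◁ cotensorι A M ▷ F) := mono_map_ι _ _ (tensorRight F ⋙ tensorLeft L)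
    have h1 : (cotensorR A M ≫ cotensorL A M ▷ F ≫ (α_ L _ F).hom) ≫ L ◁ cotensorι A M ▷ F =
        cotensorι A M ≫ A.X ◁ M.rcoact ≫ A.lcoact ▷ (M.X ⊗ F) ≫ (α_ L A.X (M.X ⊗ F)).hom ≫
          L ◁ (α_ A.X M.X F).inv := by
      rw [Category.assoc, Category.assoc, ← associator_naturality_middle,
        ← comp_whiskerRight_assoc, cotensorL_ι, comp_whiskerRight_assoc, reassoc_of% (cotensorR_ι A M)]
      simp
    have h2 : (cotensorL A M ≫ L ◁ cotensorR A M) ≫ L ◁ cotensorι A M ▷ F =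
        cotensorι A M ≫ A.lcoact ▷ M.X ≫ (L ⊗ A.X) ◁ M.rcoact ≫ (α_ L A.X (M.X ⊗ F)).hom ≫
          L ◁ (α_ A.X M.X F).inv := by
      rw [Category.assoc, ← MonoidalCategory.whiskerLeft_comp, cotensorR_ι,
        MonoidalCategory.whiskerLeft_comp, reassoc_of% (cotensorL_ι A M)]
      simp
    rw [← cancel_mono (L ◁ cotensorι A M ▷ F), h1, h2, whisker_exchange_assoc]
  isMonHom_lcoact := by
    let _ := equalizerMon (cotensorFst A M) (cotensorSnd A M)
    have := isMonHom_ι (cotensorFst A M) (cotensorSnd A M)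
    have : Mono (L ◁ cotensorι A M) := mono_map_ι _ _ (tensorLeft L)
    have : IsMonHom (cotensorL A M ≫ L ◁ cotensorι A M) := by
      rw [cotensorL_ι]; infer_instance
    exact isMonHom_of_comp_mono (cotensorL A M) (L ◁ cotensorι A M)
  isMonHom_rcoact := by
    let _ := equalizerMon (cotensorFst A M) (cotensorSnd A M)
    have := isMonHom_ι (cotensorFst A M) (cotensorSnd A M)
    have : Mono (cotensorι A M ▷ F) := mono_map_ι _ _ (tensorRight F)
    have : IsMonHom (cotensorR A M ≫ cotensorι A M ▷ F) := by
      rw [cotensorR_ι]; infer_instance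
    exact isMonHom_of_comp_mono (cotensorR A M) (cotensorι A M ▷ F)

end BicomodAlg

end Cotensor

end BraidedHopf

namespace BraidedHopf

section Transport

open Functor

universe v₁ v₂ v₃ u₁ u₂ u₃

variable {D : Type u₁} [Category.{v₁} D] [MonoidalCategory D]
variable {E : Type u₂} [Category.{v₂} E] [MonoidalCategory E]
variable {G : Type u₃} [Category.{v₃} G] [MonoidalCategory G]
variable {T : G ⥤ E} [T.Monoidal] {T' : G ⥤ D} [T'.Monoidal] {α : E ⥤ D} [α.Monoidal]
variable (τ : T ⋙ α ≅ T') [NatTrans.IsMonoidal τ.hom]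

lemma thetaIso_natural_left {M N : E} (f : M ⟶ N) (X : G) :
    α.map (f ▷ T.obj X) ≫ (thetaIso τ N X).hom = (thetaIso τ M X).hom ≫ α.map f ▷ T'.obj X := by
  rw [thetaIso_hom, thetaIso_hom, ← OplaxMonoidal.δ_natural_left_assoc, Category.assoc,
    whisker_exchange]

lemma thetaIso_natural_right (M : E) {X Y : G} (f : X ⟶ Y) :
    α.map (M ◁ T.map f) ≫ (thetaIso τ M Y).hom = (thetaIso τ M X).hom ≫ α.obj M ◁ T'.map f := by
  rw [thetaIso_hom, thetaIso_hom, ← OplaxMonoidal.δ_natural_right_assoc, Category.assoc,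
    ← MonoidalCategory.whiskerLeft_comp, ← MonoidalCategory.whiskerLeft_comp, tau_natural]

lemma thetaIso_tensor (M : E) (X Y : G) :
    α.map (M ◁ OplaxMonoidal.δ T X Y ≫ (α_ _ _ _).inv) ≫ (thetaIso τ (M ⊗ T.obj X) Y).hom ≫
        (thetaIso τ M X).hom ▷ T'.obj Y =
      (thetaIso τ M (X ⊗ Y)).hom ≫ α.obj M ◁ OplaxMonoidal.δ T' X Y ≫ (α_ _ _ _).inv := by
  simp only [thetaIso_hom, comp_whiskerRight, Category.assoc]
  rw [whisker_exchange_assoc, ← MonoidalCategory.whiskerLeft_comp_assoc, tau_tensor',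
    Functor.map_comp_assoc, ← OplaxMonoidal.associativity_inv_assoc]
  simp only [MonoidalCategory.whiskerLeft_comp, Category.assoc,
    OplaxMonoidal.δ_natural_right_assoc]
  congr 3
  rw [tensorHom_def' (τ.hom.app X), MonoidalCategory.whiskerLeft_comp_assoc,
    associator_inv_naturality_middle, associator_inv_naturality_right_assoc]
  rfl

variable {M N : E} {F : G} (χ : M ⟶ N ⊗ T.obj F)

/-- The morphism `α(M) ⟶ α(N ⊗ T F) ≅ α(N) ⊗ T' F`. -/
def transHom : α.obj M ⟶ α.obj N ⊗ T'.obj F := α.map χ ≫ (thetaIso τ N F).hom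

lemma transHom_one [MonObj M] [MonObj N] [MonObj F]
    (h : η[M] ≫ χ = (λ_ (𝟙_ _)).inv ≫ (η[N] ⊗ₘ (LaxMonoidal.ε T ≫ T.map η[F]))) :
    (LaxMonoidal.ε α ≫ α.map η[M]) ≫ transHom τ χ = (λ_ (𝟙_ _)).inv ≫
        (LaxMonoidal.ε α ≫ α.map η[N] ⊗ₘ (LaxMonoidal.ε T' ≫ T'.map η[F])) := by
  have e : LaxMonoidal.ε T' ≫ T'.map η[F] =
      LaxMonoidal.ε α ≫ α.map (LaxMonoidal.ε T ≫ T.map η[F]) ≫ τ.hom.app F := by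
    rw [← tau_unit τ, Functor.map_comp]
    simp only [Category.assoc, tau_natural]
  rw [transHom, thetaIso_hom, Category.assoc, ← Functor.map_comp_assoc α, h, e]
  rw [Functor.map_comp_assoc, ← OplaxMonoidal.δ_natural_assoc, Functor.Monoidal.map_leftUnitor_inv]
  simp only [Category.assoc, Functor.Monoidal.μ_δ_assoc]
  have e' (t : α.obj (T.obj F) ⟶ T'.obj F) (s : α.obj (𝟙_ E) ⟶ α.obj (T.obj F)) :
      LaxMonoidal.ε α ≫ (λ_ _).inv ≫ LaxMonoidal.ε α ▷ _ ≫ (α.map η[N] ⊗ₘ s) ≫ α.obj N ◁ t =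
        (λ_ (𝟙_ _)).inv ≫ (LaxMonoidal.ε α ≫ α.map η[N] ⊗ₘ LaxMonoidal.ε α ≫ s ≫ t) := by
    rw [leftUnitor_inv_naturality_assoc, ← id_tensorHom, ← id_tensorHom, ← tensorHom_id]
    simp only [tensorHom_comp_tensorHom, Category.id_comp, Category.comp_id]
  exact e' _ _

lemma transHom_mul [MonObj M] [MonObj N] [MonObj F] (b : T.obj F ⊗ N ⟶ N ⊗ T.obj F)
    (b' : T'.obj F ⊗ α.obj N ⟶ α.obj N ⊗ T'.obj F)
    (hb : τ.hom.app F ▷ α.obj N ≫ b' = (LaxMonoidal.μ α (T.obj F) N ≫ α.map b ≫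
      OplaxMonoidal.δ α N (T.obj F)) ≫ α.obj N ◁ τ.hom.app F)
    (h : μ[M] ≫ χ = (χ ⊗ₘ χ) ≫ mid N (T.obj F) b ≫ (μ[N] ⊗ₘ (LaxMonoidal.μ T F F ≫ T.map μ[F]))) :
    (LaxMonoidal.μ α _ _ ≫ α.map μ[M]) ≫ transHom τ χ =
      (transHom τ χ ⊗ₘ transHom τ χ) ≫ mid (α.obj N) (T'.obj F) b' ≫
        ((LaxMonoidal.μ α _ _ ≫ α.map μ[N]) ⊗ₘ (LaxMonoidal.μ T' F F ≫ T'.map μ[F])) := by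
  set c := LaxMonoidal.μ α (T.obj F) N ≫ α.map b ≫ OplaxMonoidal.δ α N (T.obj F) with hc
  have h1 := mid_map α N (T.obj F) N (T.obj F) b c (by simp [hc])
  have h2 := mid_natural (α.obj N) c b' (τ.hom.app F) (τ.hom.app F) hb
  have e : LaxMonoidal.μ α _ _ ≫ α.map (LaxMonoidal.μ T F F ≫ T.map μ[F]) ≫
      τ.hom.app F = (τ.hom.app F ⊗ₘ τ.hom.app F) ≫ LaxMonoidal.μ T' F F ≫ T'.map μ[F] := by
    rw [← Category.assoc (_ ⊗ₘ _), ← tau_tensor, Functor.map_comp]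
    simp only [Category.assoc, tau_natural]
  rw [transHom, thetaIso_hom, Category.assoc, ← Functor.map_comp_assoc α, h,
    Functor.map_comp_assoc, ← LaxMonoidal.μ_natural_assoc, Functor.map_comp_assoc,
    ← OplaxMonoidal.δ_natural_assoc]
  have h1' : LaxMonoidal.μ α _ _ ≫ α.map (mid N (T.obj F) b) ≫ OplaxMonoidal.δ α _ _ =
      (OplaxMonoidal.δ α N (T.obj F) ⊗ₘ OplaxMonoidal.δ α N (T.obj F)) ≫
        mid (α.obj N) (α.obj (T.obj F)) c ≫
          (LaxMonoidal.μ α N N ⊗ₘ LaxMonoidal.μ α (T.obj F) (T.obj F)) := by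
    have h3 := (OplaxMonoidal.δ α N (T.obj F) ⊗ₘ OplaxMonoidal.δ α N (T.obj F)) ≫= h1 =≫
      OplaxMonoidal.δ α _ _
    simp only [Category.assoc, Functor.Monoidal.μ_δ, tensorHom_comp_tensorHom_assoc,
      Functor.Monoidal.δ_μ, id_tensorHom_id, Category.id_comp, Category.comp_id] at h3
    exact h3.symm
  rw [reassoc_of% h1', ← tensorHom_comp_tensorHom_assoc, ← tensorHom_comp_tensorHom_assoc]
  have h2' := reassoc_of% h2
  refine congrArg _ (congrArg _ (Eq.trans ?_ (h2' _).symm))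
  refine congrArg _ ?_
  rw [← id_tensorHom, ← id_tensorHom, tensorHom_comp_tensorHom, tensorHom_comp_tensorHom]
  rw [Category.comp_id]
  refine (congrArg (fun t => (LaxMonoidal.μ α N N ≫ α.map μ[N]) ⊗ₘ t) e).trans ?_
  refine Eq.trans ?_ (tensorHom_comp_tensorHom _ _ _ _).symm
  rw [Category.id_comp]

end Transport

variable {C : Type u} [Category.{v} C] [MonoidalCategory C] [BraidedCategory C]

open LComod BicomodAlg

namespace LComod

variable {B : C} [BimonObj B]

/-- The coaction of `M` as a colinear map `M ⟶ B ⊗ Mᵗ`. -/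
@[simps] def coactRegular (M : LComod B) : M ⟶ (regular B).left ⊗ (triv B).obj M.X where
  hom := M.coact
  colinear := by
    rw [tensorObj_coact, str_trivial_right (regular B).left M.X]
    exact M.coassoc.symm

lemma coact_retraction (M : LComod B) : M.coact ≫ ε[B] ▷ M.X ≫ (λ_ M.X).hom = 𝟙 M.X := by
  rw [reassoc_of% M.counit, Iso.inv_hom_id]

lemma lift_coact (M : LComod B) {Z : C} (k : Z ⟶ B ⊗ M.X)
    (h : k ≫ B ◁ M.coact = k ≫ Δ[B] ▷ M.X ≫ (α_ B B M.X).hom) :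
    (k ≫ ε[B] ▷ M.X ≫ (λ_ M.X).hom) ≫ M.coact = k := by
  have h1 : (ε[B] ▷ M.X ≫ (λ_ M.X).hom) ≫ M.coact =
      B ◁ M.coact ≫ ε[B] ▷ (B ⊗ M.X) ≫ (λ_ (B ⊗ M.X)).hom := by
    rw [Category.assoc, ← leftUnitor_naturality, whisker_exchange_assoc]
  rw [Category.assoc, h1, reassoc_of% h, ← associator_naturality_left_assoc,
    ← comp_whiskerRight_assoc, ComonObj.counit_comul]
  simp

lemma lift_colinear (M N : LComod B) (k : N.X ⟶ B ⊗ M.X)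
    (h : k ≫ B ◁ M.coact = k ≫ Δ[B] ▷ M.X ≫ (α_ B B M.X).hom)
    (hk : k ≫ Δ[B] ▷ M.X ≫ (α_ B B M.X).hom = N.coact ≫ B ◁ k) :
    (k ≫ ε[B] ▷ M.X ≫ (λ_ M.X).hom) ≫ M.coact =
      N.coact ≫ B ◁ (k ≫ ε[B] ▷ M.X ≫ (λ_ M.X).hom) := by
  rw [M.lift_coact k h, MonoidalCategory.whiskerLeft_comp, ← reassoc_of% hk,
    MonoidalCategory.whiskerLeft_comp, ← associator_naturality_middle_assoc,
    ← comp_whiskerRight_assoc, ComonObj.comul_counit]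
  simp

/-- `B ⊗ χ : B ⊗ Mᵗ ⟶ B ⊗ (B ⊗ M)ᵗ`. -/
abbrev coactPairFst (M : LComod B) : (regular B).left ⊗ (triv B).obj M.X ⟶
    (regular B).left ⊗ (triv B).obj (B ⊗ M.X) :=
  (regular B).left ◁ (triv B).map M.coact

/-- `Δ ⊗ M : B ⊗ Mᵗ ⟶ B ⊗ (B ⊗ M)ᵗ`. -/
abbrev coactPairSnd (M : LComod B) : (regular B).left ⊗ (triv B).obj M.X ⟶
    (regular B).left ⊗ (triv B).obj (B ⊗ M.X) :=
  (regular B).rcoactHom ▷ (triv B).obj M.X ≫ (α_ _ _ _).hom ≫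
    (regular B).left ◁ Functor.LaxMonoidal.μ (triv B) B M.X

lemma coactPairSnd_hom (M : LComod B) :
    (coactPairSnd M).hom = Δ[B] ▷ M.X ≫ (α_ B B M.X).hom := by
  change Δ[B] ▷ M.X ≫ (α_ B B M.X).hom ≫ B ◁ 𝟙 (B ⊗ M.X) = _
  simp

lemma coactRegular_condition (M : LComod B) :
    coactRegular M ≫ coactPairFst M = coactRegular M ≫ coactPairSnd M :=
  LComod.hom_ext (M.coassoc.trans (congrArg (M.coact ≫ ·) (coactPairSnd_hom M).symm))

/-- The coaction of a comodule is an equalizer of comodules. -/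
def coactRegularIsLimit (M : LComod B) :
    IsLimit (Fork.ofι (coactRegular M) (coactRegular_condition M)) :=
  Fork.IsLimit.mk' _ fun s =>
    have hs : s.ι.hom ≫ B ◁ M.coact = s.ι.hom ≫ Δ[B] ▷ M.X ≫ (α_ B B M.X).hom :=
      (congrArg LComod.Hom.hom s.condition).trans
        (congrArg (s.ι.hom ≫ ·) (coactPairSnd_hom M))
    have hc : s.ι.hom ≫ Δ[B] ▷ M.X ≫ (α_ B B M.X).hom = s.pt.coact ≫ B ◁ s.ι.hom :=
      (congrArg (s.ι.hom ≫ ·) (str_trivial_right (regular B).left M.X)).symm.trans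
        s.ι.colinear
    ⟨⟨_, M.lift_colinear s.pt s.ι.hom hs hc⟩, LComod.hom_ext (M.lift_coact s.ι.hom hs),
      fun {m} hm => LComod.hom_ext (by
        have h : m.hom ≫ M.coact = s.ι.hom := congrArg LComod.Hom.hom hm
        have h' := h =≫ (ε[B] ▷ M.X ≫ (λ_ M.X).hom)
        rw [Category.assoc, M.coact_retraction] at h'
        exact (Category.comp_id _).symm.trans h')⟩

end LComod

variable {B L F : C} [BimonObj B] [BimonObj L] [BimonObj F]

/-- A bicomodule algebra morphism with invertible underlying morphism is an isomorphism. -/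
def BicomodAlg.isoOfIsIso {M N : BicomodAlg B F} (f : M ⟶ N) (e : M.X ≅ N.X)
    (h : e.hom = BicomodAlg.Hom.hom f) : M ≅ N where
  hom := f
  inv :=
    have : IsMonHom e.hom := h ▸ BicomodAlg.Hom.isMonHom f
    { hom := e.inv
      lcolinear := by
        have := BicomodAlg.Hom.lcolinear f
        rw [← h] at this
        rw [Iso.inv_comp_eq, ← Category.assoc, this]; simp
      rcolinear := by
        have := BicomodAlg.Hom.rcolinear f
        rw [← h] at this
        rw [Iso.inv_comp_eq, ← Category.assoc, this]; simp }
  hom_inv_id := BicomodAlg.Hom.ext (by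
    change BicomodAlg.Hom.hom f ≫ e.inv = 𝟙 _
    rw [← h, e.hom_inv_id])
  inv_hom_id := BicomodAlg.Hom.ext (by
    change e.inv ≫ BicomodAlg.Hom.hom f = 𝟙 _
    rw [← h, e.inv_hom_id])

variable {α : LComod B ⥤ LComod L} [α.Monoidal]

namespace Trivialization

variable (τ : Trivialization α)

/-- The colinear map `α(M) ⟶ α(B ⊗ Mᵗ) ≅ α(B) ⊗ Mᵗ`. -/
def toTensor (M : LComod B) :
    α.obj M ⟶ α.obj (regular B).left ⊗ (triv L).obj M.X :=
  transHom τ.iso (coactRegular M)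

lemma theta_natural_right (N : LComod B) {X Y : C} (f : X ⟶ Y) :
    α.map (N ◁ (triv B).map f) ≫ (τ.theta N Y).hom =
      (τ.theta N X).hom ≫ α.obj N ◁ (triv L).map f :=
  thetaIso_natural_right τ.iso N f

lemma theta_natural_left {M N : LComod B} (f : M ⟶ N) (X : C) :
    α.map (f ▷ (triv B).obj X) ≫ (τ.theta N X).hom =
      (τ.theta M X).hom ≫ α.map f ▷ (triv L).obj X :=
  thetaIso_natural_left τ.iso f X

lemma theta_tensor (N : LComod B) (X Y : C) :
    α.map ((α_ _ _ _).hom ≫ N ◁ Functor.LaxMonoidal.μ (triv B) X Y) ≫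
        (τ.theta N (X ⊗ Y)).hom =
      (τ.theta (N ⊗ (triv B).obj X) Y).hom ≫ (τ.theta N X).hom ▷ (triv L).obj Y ≫
        (α_ _ _ _).hom ≫ α.obj N ◁ Functor.LaxMonoidal.μ (triv L) X Y := by
  have h := thetaIso_tensor τ.iso N X Y
  have h2 := α.map ((α_ _ _ _).hom ≫ N ◁ Functor.LaxMonoidal.μ (triv B) X Y) ≫= h =≫
    ((α_ _ _ _).hom ≫ α.obj N ◁ Functor.LaxMonoidal.μ (triv L) X Y)
  rw [← Category.assoc (α.map _) (α.map _ ≫ _), ← Category.assoc (α.map _) (α.map _),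
    ← Functor.map_comp] at h2
  simp only [Category.assoc, Iso.inv_hom_id_assoc, ← MonoidalCategory.whiskerLeft_comp_assoc,
    ← MonoidalCategory.whiskerLeft_comp, Functor.Monoidal.δ_μ, Functor.Monoidal.μ_δ,
    MonoidalCategory.whiskerLeft_id, Category.comp_id, Category.id_comp,
    Iso.hom_inv_id] at h2
  refine h2.symm.trans ?_
  rw [CategoryTheory.Functor.map_id, Category.id_comp]
  rfl

lemma theta_coactPairFst (M : LComod B) :
    (τ.theta _ M.X).hom ≫ α.obj (regular B).left ◁ (triv L).map M.coact =
      α.map (coactPairFst M) ≫ (τ.theta _ (B ⊗ M.X)).hom :=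
  (τ.theta_natural_right _ _).symm

lemma theta_coactPairSnd (M : LComod B) :
    (τ.theta _ M.X).hom ≫ τ.coactHom (regular B) ▷ (triv L).obj M.X ≫ (α_ _ _ _).hom ≫
        α.obj (regular B).left ◁ Functor.LaxMonoidal.μ (triv L) B M.X =
      α.map (coactPairSnd M) ≫ (τ.theta _ (B ⊗ M.X)).hom := by
  rw [coactPairSnd, Functor.map_comp_assoc, theta_tensor, ← Category.assoc (α.map _),
    theta_natural_left, Trivialization.coactHom, comp_whiskerRight]
  simp only [Category.assoc]

/-- `α(M) ⟶ α(B) ⊗ M` is right colinear. -/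
lemma toTensor_rcoact (M : BicomodAlg B F) :
    τ.toTensor M.left ≫ α.obj (regular B).left ◁ (triv L).map M.rcoact =
      τ.coactHom M ≫ τ.toTensor M.left ▷ (triv L).obj F ≫ (α_ _ _ _).hom ≫
        α.obj (regular B).left ◁ Functor.LaxMonoidal.μ (triv L) M.X F := by
  have h : LComod.coactRegular M.left ≫ (regular B).left ◁ (triv B).map M.rcoact =
      M.rcoactHom ≫ LComod.coactRegular M.left ▷ (triv B).obj F ≫ (α_ _ _ _).hom ≫
        (regular B).left ◁ Functor.LaxMonoidal.μ (triv B) M.X F := by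
    ext
    change M.lcoact ≫ B ◁ M.rcoact = M.rcoact ≫ M.lcoact ▷ F ≫ (α_ B M.X F).hom ≫ B ◁ 𝟙 (M.X ⊗ F)
    rw [← M.bicomod]
    simp
  have e1 : τ.toTensor M.left ≫ α.obj (regular B).left ◁ (triv L).map M.rcoact =
      α.map (LComod.coactRegular M.left ≫ (regular B).left ◁ (triv B).map M.rcoact) ≫
        (τ.theta _ _).hom := by
    rw [Functor.map_comp, Category.assoc, theta_natural_right]
    exact Category.assoc _ _ _
  rw [e1, h, Functor.map_comp_assoc, Functor.map_comp_assoc, theta_tensor,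
    ← Category.assoc (α.map (_ ▷ _)), theta_natural_left]
  simp only [Trivialization.coactHom, Category.assoc]
  rw [← comp_whiskerRight_assoc]
  rfl

variable (hA : ConditionA α)

lemma toTensor_one (M : BicomodAlg B F) :
    η[(τ.image hA M).X] ≫ (τ.toTensor M.left).hom =
      η[(τ.image hA (regular B)).X ⊗ M.X] := by
  have h := transHom_one τ.iso (LComod.coactRegular M.left) (M := M.left)
    (N := (regular B).left) (F := M.X) (by
      ext
      change η[M.X] ≫ M.lcoact = (λ_ (𝟙_ C)).inv ≫ (η[B] ⊗ₘ (𝟙 _ ≫ η[M.X]))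
      rw [IsMonHom.one_hom, MonObj.tensorObj.one_def, Category.id_comp])
  refine (congrArg LComod.Hom.hom h).trans ?_
  rw [MonObj.tensorObj.one_def]
  exact congrArg (fun t => (λ_ (𝟙_ C)).inv ≫ (η[(τ.image hA (regular B)).X] ⊗ₘ t))
    (Category.id_comp η[M.X])

lemma toTensor_mul (M : BicomodAlg B F) :
    μ[(τ.image hA M).X] ≫ (τ.toTensor M.left).hom =
      ((τ.toTensor M.left).hom ⊗ₘ (τ.toTensor M.left).hom) ≫
        μ[(τ.image hA (regular B)).X ⊗ M.X] := by
  have h := transHom_mul τ.iso (LComod.coactRegular M.left) (M := M.left)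
    (N := (regular B).left) (F := M.X) _ _ (τ.tau_halfBraiding hA M.X (regular B).left) (by
      ext
      change μ[M.X] ≫ M.lcoact = (M.lcoact ⊗ₘ M.lcoact) ≫ tensorμ B M.X B M.X ≫
        (μ[B] ⊗ₘ (𝟙 _ ≫ μ[M.X]))
      rw [IsMonHom.mul_hom, MonObj.tensorObj.mul_def, Category.id_comp])
  refine (congrArg LComod.Hom.hom h).trans ?_
  rw [MonObj.tensorObj.mul_def]
  exact congrArg (fun t => ((τ.toTensor M.left).hom ⊗ₘ (τ.toTensor M.left).hom) ≫
    tensorμ _ _ _ _ ≫ (μ[(τ.image hA (regular B)).X] ⊗ₘ t)) (Category.id_comp μ[M.X])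

lemma isMonHom_toTensor (M : BicomodAlg B F) :
    IsMonHom (M := (τ.image hA M).X) (N := (τ.image hA (regular B)).X ⊗ M.X)
      (τ.toTensor M.left).hom :=
  ⟨τ.toTensor_one hA M, τ.toTensor_mul hA M⟩

lemma cotensorPair_iff (M : BicomodAlg B F) {N : LComod L}
    (k : N ⟶ α.obj (regular B).left ⊗ (triv L).obj M.X) :
    k.hom ≫ cotensorFst (τ.image hA (regular B)) M = k.hom ≫ cotensorSnd (τ.image hA (regular B)) M ↔
      (k ≫ (τ.theta _ M.X).inv) ≫ α.map (coactPairFst M.left) =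
        (k ≫ (τ.theta _ M.X).inv) ≫ α.map (coactPairSnd M.left) := by
  have h1 : (k ≫ (τ.theta _ M.X).inv) ≫ α.map (coactPairFst M.left) ≫
      (τ.theta _ (B ⊗ M.X)).hom = k ≫ α.obj (regular B).left ◁ (triv L).map M.lcoact := by
    rw [← theta_coactPairFst, Category.assoc, Iso.inv_hom_id_assoc]
  have h2 : (k ≫ (τ.theta _ M.X).inv) ≫ α.map (coactPairSnd M.left) ≫
      (τ.theta _ (B ⊗ M.X)).hom = k ≫ τ.coactHom (regular B) ▷ (triv L).obj M.X ≫
        (α_ _ _ _).hom ≫ α.obj (regular B).left ◁ Functor.LaxMonoidal.μ (triv L) B M.X := by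
    rw [← theta_coactPairSnd, Category.assoc, Iso.inv_hom_id_assoc]
  have h3 (i : N.X ⟶ (τ.image hA (regular B)).X ⊗ M.X) :
      i ≫ cotensorFst (τ.image hA (regular B)) M = i ≫ cotensorSnd (τ.image hA (regular B)) M ↔
        i ≫ _ ◁ M.lcoact = i ≫ (τ.image hA (regular B)).rcoact ▷ M.X ≫ (α_ _ B M.X).hom ≫
          _ ◁ 𝟙 (B ⊗ M.X) := by
    rw [MonoidalCategory.whiskerLeft_id, Category.comp_id,
      ← cancel_mono (α_ (τ.image hA (regular B)).X B M.X).hom]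
    simp only [Category.assoc, Iso.inv_hom_id, Category.comp_id]
    exact eq_comm
  refine (h3 _).trans ?_
  rw [← cancel_mono (τ.theta _ (B ⊗ M.X)).hom, Category.assoc _ (α.map _),
    Category.assoc _ (α.map _), h1, h2, LComod.hom_ext_iff]
  rfl

lemma toTensor_condition (M : BicomodAlg B F) :
    (τ.toTensor M.left).hom ≫ cotensorFst (τ.image hA (regular B)) M =
      (τ.toTensor M.left).hom ≫ cotensorSnd (τ.image hA (regular B)) M := by
  refine (τ.cotensorPair_iff hA M (τ.toTensor M.left)).2 ?_
  have h : τ.toTensor M.left ≫ (τ.theta _ M.X).inv = α.map (coactRegular M.left) :=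
    (Iso.comp_inv_eq _).2 rfl
  rw [h, ← Functor.map_comp, coactRegular_condition, Functor.map_comp]

variable [HasEqualizers C]

/-- The morphism `α(M) ⟶ α(B) □_B M` through which `α(M) ⟶ α(B) ⊗ M` factors. -/
noncomputable def toCotensorX (M : BicomodAlg B F) :
    (τ.image hA M).X ⟶ cotensorX (τ.image hA (regular B)) M :=
  equalizer.lift (τ.toTensor M.left).hom (τ.toTensor_condition hA M)

lemma toCotensorX_ι (M : BicomodAlg B F) :
    τ.toCotensorX hA M ≫ cotensorι (τ.image hA (regular B)) M = (τ.toTensor M.left).hom :=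
  equalizer.lift_ι _ _

lemma toCotensorX_lcolinear [Flat L] (M : BicomodAlg B F) :
    τ.toCotensorX hA M ≫ cotensorL (τ.image hA (regular B)) M =
      (τ.image hA M).lcoact ≫ L ◁ τ.toCotensorX hA M := by
  have : Mono (L ◁ cotensorι (τ.image hA (regular B)) M) := mono_map_ι _ _ (tensorLeft L)
  rw [← cancel_mono (L ◁ cotensorι (τ.image hA (regular B)) M), Category.assoc, Category.assoc,
    ← MonoidalCategory.whiskerLeft_comp, toCotensorX_ι, cotensorL_ι, ← Category.assoc,
    toCotensorX_ι]
  exact (congrArg ((τ.toTensor M.left).hom ≫ ·)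
    (str_trivial_right (α.obj (regular B).left) M.X)).symm.trans (τ.toTensor M.left).colinear

lemma toCotensorX_rcolinear [Flat F] (M : BicomodAlg B F) :
    τ.toCotensorX hA M ≫ cotensorR (τ.image hA (regular B)) M =
      (τ.image hA M).rcoact ≫ τ.toCotensorX hA M ▷ F := by
  have : Mono (cotensorι (τ.image hA (regular B)) M ▷ F) := mono_map_ι _ _ (tensorRight F)
  rw [← cancel_mono (cotensorι (τ.image hA (regular B)) M ▷ F), Category.assoc, Category.assoc,
    ← comp_whiskerRight, toCotensorX_ι, cotensorR_ι, ← Category.assoc, toCotensorX_ι,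
    ← cancel_mono (α_ (τ.image hA (regular B)).X M.X F).hom]
  have h : (τ.toTensor M.left).hom ≫ (α.obj (regular B).left).X ◁ M.rcoact =
      (τ.image hA M).rcoact ≫ (τ.toTensor M.left).hom ▷ F ≫
        (α_ (α.obj (regular B).left).X M.X F).hom ≫
          (α.obj (regular B).left).X ◁ 𝟙 (M.X ⊗ F) :=
    congrArg LComod.Hom.hom (τ.toTensor_rcoact M)
  rw [MonoidalCategory.whiskerLeft_id, Category.comp_id] at h
  have h' (i : (τ.image hA M).X ⟶ (τ.image hA (regular B)).X ⊗ M.X) :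
      (i ≫ (τ.image hA (regular B)).X ◁ M.rcoact ≫ (α_ _ M.X F).inv) ≫ (α_ _ M.X F).hom =
        i ≫ (τ.image hA (regular B)).X ◁ M.rcoact := by
    simp
  exact (h' _).trans (h.trans (Category.assoc _ _ _).symm)

variable [Flat L] [Flat F]

/-- The comparison morphism `α(M) ⟶ α(B) □_B M` of bicomodule algebras. -/
noncomputable def toCotensor (M : BicomodAlg B F) :
    τ.image hA M ⟶ (τ.image hA (regular B)).cotensor M :=
  letI A := τ.image hA (regular B)
  { hom := τ.toCotensorX hA M
    isMonHom :=
      letI := equalizerMon (cotensorFst A M) (cotensorSnd A M)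
      haveI := isMonHom_ι (cotensorFst A M) (cotensorSnd A M)
      haveI : IsMonHom (τ.toCotensorX hA M ≫ cotensorι A M) := by
        rw [toCotensorX_ι]
        exact τ.isMonHom_toTensor hA M
      isMonHom_of_comp_mono (τ.toCotensorX hA M) (cotensorι A M)
    lcolinear := τ.toCotensorX_lcolinear hA M
    rcolinear := τ.toCotensorX_rcolinear hA M }

/-- `α(B) □_B M ⟶ α(B) ⊗ M` as a colinear map to `α(B) ⊗ Mᵗ`. -/
noncomputable def cotensorιHom (M : BicomodAlg B F) :
    ((τ.image hA (regular B)).cotensor M).left ⟶ α.obj (regular B).left ⊗ (triv L).obj M.X where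
  hom := cotensorι (τ.image hA (regular B)) M
  colinear :=
    (congrArg (cotensorι (τ.image hA (regular B)) M ≫ ·)
      (str_trivial_right (α.obj (regular B).left) M.X)).trans (cotensorL_ι _ M).symm

/-- `toCotensor` on underlying left comodules. -/
noncomputable def toCotensorLeft (M : BicomodAlg B F) :
    α.obj M.left ⟶ ((τ.image hA (regular B)).cotensor M).left :=
  ⟨τ.toCotensorX hA M, BicomodAlg.Hom.lcolinear (τ.toCotensor hA M)⟩

lemma toCotensorLeft_ι (M : BicomodAlg B F) :
    τ.toCotensorLeft hA M ≫ τ.cotensorιHom hA M = τ.toTensor M.left :=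
  LComod.hom_ext (τ.toCotensorX_ι hA M)

variable [α.IsEquivalence]

/-- `α` preserves the equalizer `M ⟶ B ⊗ Mᵗ`. -/
noncomputable def mapCoactRegularIsLimit (M : LComod B) :=
  isLimitForkMapOfIsLimit α (coactRegular_condition M) (coactRegularIsLimit M)

/-- The inverse of `toCotensorLeft`. -/
noncomputable def fromCotensorLeft (M : BicomodAlg B F) :
    ((τ.image hA (regular B)).cotensor M).left ⟶ α.obj M.left :=
  Fork.IsLimit.lift (mapCoactRegularIsLimit (α := α) M.left)
    (τ.cotensorιHom hA M ≫ (τ.theta (regular B).left M.X).inv)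
    ((τ.cotensorPair_iff hA M (τ.cotensorιHom hA M)).1
      (equalizer.condition _ _))

lemma fromCotensorLeft_map (M : BicomodAlg B F) :
    τ.fromCotensorLeft hA M ≫ α.map (coactRegular M.left) =
      τ.cotensorιHom hA M ≫ (τ.theta (regular B).left M.X).inv :=
  Fork.IsLimit.lift_ι' (mapCoactRegularIsLimit (α := α) M.left) _ _

lemma fromCotensorLeft_toTensor (M : BicomodAlg B F) :
    τ.fromCotensorLeft hA M ≫ τ.toTensor M.left =
      τ.cotensorιHom hA M := by
  have h := τ.fromCotensorLeft_map hA M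
  refine (Category.assoc _ _ _).symm.trans ?_
  exact (Iso.eq_comp_inv _).1 h

/-- `α(M) ≅ α(B) □_B M` as left comodules. -/
noncomputable def cotensorIsoLeft (M : BicomodAlg B F) :
    α.obj M.left ≅ ((τ.image hA (regular B)).cotensor M).left where
  hom := τ.toCotensorLeft hA M
  inv := τ.fromCotensorLeft hA M
  hom_inv_id := by
    refine Fork.IsLimit.hom_ext (mapCoactRegularIsLimit (α := α) M.left) ?_
    change (_ ≫ _) ≫ α.map (coactRegular M.left) = 𝟙 _ ≫ α.map (coactRegular M.left)
    rw [Category.assoc, fromCotensorLeft_map, ← Category.assoc, Category.id_comp]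
    exact (congrArg (· ≫ (τ.theta (regular B).left M.X).inv) (τ.toCotensorLeft_ι hA M)).trans
      ((Iso.comp_inv_eq _).2 rfl)
  inv_hom_id := by
    have h : (τ.fromCotensorLeft hA M ≫ τ.toCotensorLeft hA M) ≫
        τ.cotensorιHom hA M = τ.cotensorιHom hA M := by
      rw [Category.assoc, toCotensorLeft_ι, fromCotensorLeft_toTensor]
    refine LComod.hom_ext ((cancel_mono (cotensorι (τ.image hA (regular B)) M)).1 ?_)
    exact (congrArg LComod.Hom.hom h).trans (Category.id_comp _).symm

/-- `α(M) ≅ α(B) □_B M` as bicomodule algebras. -/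
noncomputable def imageIsoCotensor (M : BicomodAlg B F) :
    τ.image hA M ≅ (τ.image hA (regular B)).cotensor M :=
  isoOfIsIso (τ.toCotensor hA M)
    { hom := (τ.cotensorIsoLeft hA M).hom.hom
      inv := (τ.cotensorIsoLeft hA M).inv.hom
      hom_inv_id := congrArg LComod.Hom.hom (τ.cotensorIsoLeft hA M).hom_inv_id
      inv_hom_id := congrArg LComod.Hom.hom (τ.cotensorIsoLeft hA M).inv_hom_id } rfl

end Trivialization

end BraidedHopf

theorem proposition2 {C : Type u} [Category.{v} C] [MonoidalCategory C] [BraidedCategory C]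
    [HasEqualizers C] (B L F : C) [HopfObj B] [HopfObj L] [HopfObj F]
    [BraidedHopf.Flat B] [BraidedHopf.Flat L] [BraidedHopf.Flat F]
    (α : BraidedHopf.LComod B ⥤ BraidedHopf.LComod L) [α.Monoidal] [α.IsEquivalence]
    (τ : BraidedHopf.Trivialization α) (hA : BraidedHopf.ConditionA α)
    (M : BraidedHopf.BicomodAlg B F) :
    Nonempty (τ.image hA M ≅ (τ.image hA (BraidedHopf.BicomodAlg.regular B)).cotensor M) :=
  ⟨τ.imageIsoCotensor hA M⟩
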